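/- A binary tree is either a single leaf or an inner node with an ordered pair of binary trees as left and right subtrees; its size is its number of inner nodes. The register function is defined by $\operatorname{Reg}(t)=0$ if $t$ is a single leaf, and, if $t$ has subtrees $t_1,t_2$, by $\operatorname{Reg}(t)=\max\{\operatorname{Reg}(t_1),\operatorname{Reg}(t_2)\}$ if $\operatorname{Reg}(t_1)\ne\operatorname{Reg}(t_2)$ and $\operatorname{Reg}(t)=\operatorname{Reg}(t_1)+1$ otherwise. Label every node (inner node or leaf) of a binary tree by the value of the register function of the subtree rooted at it. For $r\ge 0$, an $r$-branch is a maximal chain of nodes labelled $r$, i.e. a connected component of the subgraph induced by the nodes with label $r$. Let $X_{n;r}$ be the number of $r$-branches of a uniformly random binary tree of size $n$, and let $X_n=\sum_{r\ge0}X_{n;r}$ be the total number of branches. Theorem. As $n\to\infty$, $$\mathbb{E}X_n=\frac{4n}{3}+\frac16\log_4 n-\frac{2\zeta'(-1)}{\log 2}-\frac{\gamma}{12\log 2}-\frac{1}{6\log 2}+\frac{43}{36}+\delta(\log_4 n)+O\Big(\frac{\log n}{n}\Big),$$ where $\zeta$ is the Riemann zeta function, $\gamma$ is the Euler--Mascheroni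 constant, and $$\delta(x)=\frac{1}{\log 2}\sum_{k\in\mathbb{Z}\setminus\{0\}}\Gamma\Big(\frac{\chi_k}{2}\Big)\zeta(\chi_k-1)(\chi_k-1)e^{2\pi i k x},\qquad \chi_k=\frac{2\pi i k}{\log 2}.$$ The Fourier series converges absolutely, and $\delta$ is a continuous, real-valued, $1$-periodic function with mean $\int_0^1\delta(x)\,dx=0$. -/

import Mathlib

namespace TreeBranches

open BinaryTree

/-- The register function (Horton–Strahler number) of a binary tree; `nil` is the tree that
consists of a single leaf. -/
def reg : BinaryTree Unit → ℕ
  | .nil => 0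
  | .node _ l r => if reg l = reg r then reg l + 1 else max (reg l) (reg r)

/-- The nodes of a binary tree, inner nodes as well as leaves. -/
inductive Node : BinaryTree Unit → Type
  | root (t : BinaryTree Unit) : Node t
  | left {a : Unit} {l r : BinaryTree Unit} (p : Node l) : Node (.node a l r)
  | right {a : Unit} {l r : BinaryTree Unit} (p : Node r) : Node (.node a l r)

/-- The subtree rooted at a node. -/
def Node.subtree : {t : BinaryTree Unit} → Node t → BinaryTree Unit
  | _, .root t => t
  | _, .left p => p.subtree
  | _, .right p => p.subtree

/-- The label of a node: the register function of the subtree rooted at it. -/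
def Node.label {t : BinaryTree Unit} (p : Node t) : ℕ := reg p.subtree

/-- `IsParent p q`: the node `q` is one of the two children of the inner node `p`. -/
inductive IsParent : {t : BinaryTree Unit} → Node t → Node t → Prop
  | root_left {a : Unit} {l r : BinaryTree Unit} :
      IsParent (Node.root (.node a l r)) (Node.left (Node.root l))
  | root_right {a : Unit} {l r : BinaryTree Unit} :
      IsParent (Node.root (.node a l r)) (Node.right (Node.root r))
  | left {a : Unit} {l r : BinaryTree Unit} {p q : Node l} (h : IsParent p q) :
      IsParent (Node.left p : Node (.node a l r)) (Node.left q)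
  | right {a : Unit} {l r : BinaryTree Unit} {p q : Node r} (h : IsParent p q) :
      IsParent (Node.right p : Node (.node a l r)) (Node.right q)

/-- A binary tree as an undirected graph on its nodes: the edges join parents and children. -/
def treeGraph (t : BinaryTree Unit) : SimpleGraph (Node t) := SimpleGraph.fromRel IsParent

/-- The `r`-branches of `t`: the connected components of the subgraph induced by the nodes with
label `r`, that is, the maximal chains of nodes labelled `r`. -/
abbrev Branch (t : BinaryTree Unit) (r : ℕ) : Type :=
  ((treeGraph t).induce {p : Node t | p.label = r}).ConnectedComponent

instance instFiniteNode (t : BinaryTree Unit) : Finite (Node t) := by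
  induction t with
  | nil =>
    refine Finite.of_surjective (fun _ : Unit => Node.root .nil) ?_
    intro p
    cases p
    exact ⟨(), rfl⟩
  | node a l r hl hr =>
    refine Finite.of_surjective (fun x : Unit ⊕ (Node l ⊕ Node r) =>
      match x with
      | .inl _ => Node.root (.node a l r)
      | .inr (.inl p) => Node.left p
      | .inr (.inr p) => Node.right p) ?_
    intro p
    cases p with
    | root => exact ⟨.inl (), rfl⟩
    | left p => exact ⟨.inr (.inl p), rfl⟩
    | right p => exact ⟨.inr (.inr p), rfl⟩

/-- The number of `r`-branches of `t` (a genuine cardinality, as `Node t` is finite). -/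
noncomputable def numBranches (t : BinaryTree Unit) (r : ℕ) : ℕ := Nat.card (Branch t r)

theorem Node.label_le_reg {t : BinaryTree Unit} (p : Node t) : p.label ≤ reg t := by
  induction p with
  | root t => exact le_rfl
  | @left a l r p ih =>
    have h : p.label ≤ reg (.node a l r) := by
      rw [reg]
      split_ifs <;> omega
    exact h
  | @right a l r p ih =>
    have h : p.label ≤ reg (.node a l r) := by
      rw [reg]
      split_ifs <;> omega
    exact h

/-- Only finitely many `r` contribute to the total number of branches. -/
theorem finite_support_numBranches (t : BinaryTree Unit) :
    (Function.support (numBranches t)).Finite := by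
  refine (Set.finite_Iic (reg t)).subset fun r hr => ?_
  obtain ⟨c⟩ := (Nat.card_ne_zero.mp hr).1
  obtain ⟨⟨p, hp⟩, -⟩ := c.exists_rep
  exact Set.mem_Iic.mpr (hp ▸ p.label_le_reg)

/-- The total number of branches of `t`, the sum of the numbers of `r`-branches over all `r ≥ 0`. -/
noncomputable def totalBranches (t : BinaryTree Unit) : ℕ := ∑ᶠ r : ℕ, numBranches t r

/-- The expected total number of branches of a binary tree that is uniformly distributed on the
finite set of all binary trees with `n` inner nodes. -/
noncomputable def expectedBranches (n : ℕ) : ℝ :=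
  (∑ t ∈ treesOfNumNodesEq n, (totalBranches t : ℝ)) / (treesOfNumNodesEq n).card

/-- `χ_k = 2πik / log 2`. -/
noncomputable def chi (k : ℤ) : ℂ := 2 * Real.pi * Complex.I * k / Real.log 2

/-- The coefficient of `e^{2πikx}` in the Fourier series of the fluctuation, for `k ≠ 0`. -/
noncomputable def deltaCoeff (k : ℤ) : ℂ :=
  1 / Real.log 2 * (Complex.Gamma (chi k / 2) * riemannZeta (chi k - 1) * (chi k - 1))

/-- The fluctuation `δ`, as the sum of its Fourier series over all integers `k ≠ 0`. -/
noncomputable def delta (x : ℝ) : ℂ :=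
  ∑' k : {k : ℤ // k ≠ 0}, deltaCoeff k * Complex.exp (2 * Real.pi * Complex.I * (k : ℤ) * x)

end TreeBranches

/-! Combinatorics. Each branch has a unique topmost node, so branches can be counted by their
topmost nodes. Joining two trees under a new root creates a branch exactly when the two registers
agree (`totalBranches_node`). With `T` the series of all trees and `R_r` the series of trees with
register `r`, this recursion is linear in the branch series. Hence the `r`-branches have series `(1
- 2zT)⁻¹ z R_{r-1}²` for `r ≥ 1` and `(1 - 2zT)⁻¹` for `r = 0`. In the variable `u = T - 1`, where
`z = u / (1 + u)²`, every one of these equals `rootSeries * (1 - u)² u^(2^r - 1) / (1 - u^(2^r))²`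
(`branchSeries_mul`). Expanding the denominator and using `[zⁿ] rootSeries * u^m = C(2n, n+m)`
expresses the expectation as a double sum over `r` and `k` of `k w(k 2^r)`, where `w` is a second
difference of binomial coefficients divided by a Catalan number (`expectedBranches_eq_tsum`).

Analysis. Put `M = n + 3/2` and `v = m² / M`. Then `w(m) = (4v - 2) e^{-v}` plus an explicit term of
order `1/M`, with error of order `1/M²` (`exists_abs_branchWeight_sub_le`). The expectation becomes
the sum over `r ≥ 0` of `brSum (4^r / M) + corrSum (4^r / M) / M`. Euler–Maclaurin summation gives
`brSum t = 1/t + 1/6 + O(t)` and `corrSum t = -2/(3t) + O(t)` near `0`; both are `O(t⁻²)` at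
infinity. The correction contributes the constant `-8/9`.

The main sum is completed to a two-sided sum over all integers `r` with the divergent part removed.
As a function of `x = log_4 M` this is `4^x / 3 + x / 6` plus a continuous 1-periodic function
`brPer`. Unfolding turns the Fourier coefficients of `brPer` into values of the Mellin transform of
the regularised `brSum` at `chi k / 2`, and that transform is `(4s - 2) Γ(s) ζ(2s - 1) - 1/(s - 1) -
1/(6s)`, with the singularity at `s = 0` removed. The coefficients with `k ≠ 0` are `deltaCoeff k`;
the one with `k = 0` contains `ζ'(-1)` and `γ`. They are summable, so the Fourier series represents
`brPer` pointwise and `delta = brPer - brMean`. Since `delta` is Lipschitz, `M` can be replaced by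
`n` at a cost of `O(1/n)`. -/

namespace TreeBranches

open BinaryTree

/-! ### Branches and their topmost nodes -/

open Classical in
/-- The topmost node of the branch that contains a given node. -/
noncomputable def Node.top : {t : BinaryTree Unit} → Node t → Node t
  | _, .root t => .root t
  | _, @Node.left a l r p =>
    if p.top = .root l ∧ reg l = reg (.node a l r) then .root _ else .left p.top
  | _, @Node.right a l r p =>
    if p.top = .root r ∧ reg r = reg (.node a l r) then .root _ else .right p.top

theorem Node.top_left {a : Unit} {l r : BinaryTree Unit} (p : Node l) [Decidable
    (p.top = .root l ∧ reg l = reg (.node a l r))] : (Node.left p : Node (.node a l r)).top =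
    if p.top = .root l ∧ reg l = reg (.node a l r) then .root _ else .left p.top := by
  rw [Node.top]; congr

theorem Node.top_right {a : Unit} {l r : BinaryTree Unit} (p : Node r) [Decidable
    (p.top = .root r ∧ reg r = reg (.node a l r))] : (Node.right p : Node (.node a l r)).top =
    if p.top = .root r ∧ reg r = reg (.node a l r) then .root _ else .right p.top := by
  rw [Node.top]; congr

theorem Node.label_top {t : BinaryTree Unit} (p : Node t) : p.top.label = p.label := by
  classical
  induction p with
  | root t => rfl
  | @left a l r p ih =>
    rw [Node.top_left]
    split_ifs with h
    · rw [h.1] at ih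
      exact h.2.symm.trans ih
    · exact ih
  | @right a l r p ih =>
    rw [Node.top_right]
    split_ifs with h
    · rw [h.1] at ih
      exact h.2.symm.trans ih
    · exact ih

/-- Together with `Node.reflTransGen_top` this makes `top` a section of the map from nodes to
branches: it is constant along edges inside a branch, and each node is reached from its top without
leaving the branch. -/
theorem IsParent.top_eq {t : BinaryTree Unit} {p q : Node t} (h : IsParent p q)
    (hl : p.label = q.label) : p.top = q.top := by
  classical
  induction h with
  | @root_left a l r =>
    rw [Node.top_left, if_pos ⟨rfl, hl.symm⟩]; rfl
  | @root_right a l r =>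
    rw [Node.top_right, if_pos ⟨rfl, hl.symm⟩]; rfl
  | left h ih => rw [Node.top_left, Node.top_left, ih hl]
  | right h ih => rw [Node.top_right, Node.top_right, ih hl]

theorem Node.reflTransGen_top {t : BinaryTree Unit} (p : Node t) :
    Relation.ReflTransGen (fun p q : Node t => IsParent p q ∧ p.label = q.label) p.top p := by
  classical
  induction p with
  | root t => exact .refl
  | @left a l r p ih =>
    have key := ih.lift (Node.left : Node l → Node (.node a l r))
      (p := fun p q => IsParent p q ∧ p.label = q.label) (fun _ _ h => ⟨h.1.left, h.2⟩)
    rw [Node.top_left]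
    split_ifs with h
    · rw [h.1] at key
      exact .head ⟨.root_left, h.2.symm⟩ key
    · exact key
  | @right a l r p ih =>
    have key := ih.lift (Node.right : Node r → Node (.node a l r))
      (p := fun p q => IsParent p q ∧ p.label = q.label) (fun _ _ h => ⟨h.1.right, h.2⟩)
    rw [Node.top_right]
    split_ifs with h
    · rw [h.1] at key
      exact .head ⟨.root_right, h.2.symm⟩ key
    · exact key

theorem Node.top_top {t : BinaryTree Unit} (p : Node t) : p.top.top = p.top := by
  have h : ∀ q : Node t, Relation.ReflTransGen
      (fun p q : Node t => IsParent p q ∧ p.label = q.label) q p → q.top = p.top := by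
    intro q hq
    induction hq using Relation.ReflTransGen.head_induction_on with
    | refl => rfl
    | head h _ ih => exact (h.1.top_eq h.2).trans ih
  exact h _ p.reflTransGen_top

theorem IsParent.ne {t : BinaryTree Unit} {p q : Node t} (h : IsParent p q) : p ≠ q := by
  induction h with
  | root_left => intro h; cases h
  | root_right => intro h; cases h
  | left _ ih => intro h; cases h; exact ih rfl
  | right _ ih => intro h; cases h; exact ih rfl

theorem reachable_of_reflTransGen {t : BinaryTree Unit} {r : ℕ} {p q : Node t}
    (h : Relation.ReflTransGen (fun p q : Node t => IsParent p q ∧ p.label = q.label) p q)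
    (hp : p.label = r) (hq : q.label = r) :
    ((treeGraph t).induce {p : Node t | p.label = r}).Reachable ⟨p, hp⟩ ⟨q, hq⟩ := by
  induction h using Relation.ReflTransGen.head_induction_on with
  | refl => exact .refl _
  | @head a c h _ ih =>
    refine SimpleGraph.Reachable.trans (SimpleGraph.Adj.reachable ?_) (ih (h.2 ▸ hp))
    simp only [SimpleGraph.comap_adj, treeGraph, SimpleGraph.fromRel_adj,
      Function.Embedding.subtype_apply]
    exact ⟨h.1.ne, .inl h.1⟩

theorem top_eq_of_reachable {t : BinaryTree Unit} {r : ℕ} {p q : {p : Node t | p.label = r}}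
    (h : ((treeGraph t).induce {p : Node t | p.label = r}).Reachable p q) :
    p.1.top = q.1.top := by
  obtain ⟨w⟩ := h
  induction w with
  | nil => rfl
  | @cons a b c hab _ ih =>
    refine Eq.trans ?_ ih
    simp only [SimpleGraph.comap_adj, treeGraph, SimpleGraph.fromRel_adj,
      Function.Embedding.subtype_apply] at hab
    have hl : a.1.label = b.1.label := a.2.trans b.2.symm
    rcases hab.2 with h | h
    · exact h.top_eq hl
    · exact (h.top_eq hl.symm).symm

theorem numBranches_eq_card_top (t : BinaryTree Unit) (r : ℕ) :
    numBranches t r = Nat.card {p : Node t // p.top = p ∧ p.label = r} := by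
  refine (Nat.card_congr (Equiv.ofBijective (fun p : {p : Node t // p.top = p ∧ p.label = r} =>
    ((treeGraph t).induce {p : Node t | p.label = r}).connectedComponentMk ⟨p.1, p.2.2⟩)
    ⟨?_, ?_⟩)).symm
  · intro p q h
    have := top_eq_of_reachable (SimpleGraph.ConnectedComponent.exact h)
    rw [p.2.1, q.2.1] at this
    exact Subtype.ext this
  · intro c
    obtain ⟨⟨p, hp⟩, rfl⟩ := c.exists_rep
    exact ⟨⟨p.top, p.top_top, p.label_top.trans hp⟩, SimpleGraph.ConnectedComponent.sound
      (reachable_of_reflTransGen p.reflTransGen_top (p.label_top.trans hp) hp)⟩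

/-! ### Recursion for the total number of branches. -/

noncomputable instance instFintypeNode (t : BinaryTree Unit) : Fintype (Node t) :=
  Fintype.ofFinite _

open Classical in
theorem totalBranches_eq_sum (t : BinaryTree Unit) :
    totalBranches t = ∑ p : Node t, if p.top = p then 1 else 0 := by
  have hs : Function.support (numBranches t) ⊆ (Finset.range (reg t + 1) : Set ℕ) := by
    intro r hr
    obtain ⟨c⟩ := (Nat.card_ne_zero.mp hr).1
    obtain ⟨⟨p, hp⟩, -⟩ := c.exists_rep
    have hp' : p.label = r := hp
    have := p.label_le_reg
    simp only [Finset.coe_range, Set.mem_Iio]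
    omega
  rw [totalBranches, finsum_eq_sum_of_support_subset _ hs, Finset.sum_boole, Nat.cast_id,
    Finset.card_eq_sum_card_fiberwise (f := Node.label) (t := Finset.range (reg t + 1))]
  · refine Finset.sum_congr rfl fun r _ => ?_
    rw [numBranches_eq_card_top, Nat.card_eq_fintype_card, Fintype.card_subtype,
      Finset.filter_filter]
  · intro p _
    have := p.label_le_reg
    simp only [Finset.coe_range, Set.mem_Iio]
    omega

/-- The nodes of a tree: the root, and the nodes of both subtrees. -/
def nodeEquiv (a : Unit) (l r : BinaryTree Unit) :
    Unit ⊕ (Node l ⊕ Node r) ≃ Node (.node a l r) where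
  toFun
    | .inl _ => Node.root (.node a l r)
    | .inr (.inl p) => Node.left p
    | .inr (.inr p) => Node.right p
  invFun
    | .root _ => .inl ()
    | .left p => .inr (.inl p)
    | .right p => .inr (.inr p)
  left_inv := by rintro (_ | _ | _) <;> rfl
  right_inv := by intro p; cases p <;> rfl

theorem totalBranches_nil : totalBranches .nil = 1 := by
  classical
  rw [totalBranches_eq_sum, Fintype.sum_eq_single (Node.root .nil)]
  · exact if_pos rfl
  · intro p hp
    cases p
    exact absurd rfl hp

/-- The new root is always a topmost node. The root of a child stops being one exactly when its
label equals that of the new root; all other nodes keep their status. -/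
theorem totalBranches_node (a : Unit) (l r : BinaryTree Unit) :
    totalBranches (.node a l r) =
      totalBranches l + totalBranches r + if reg l = reg r then 1 else 0 := by
  classical
  rw [totalBranches_eq_sum, totalBranches_eq_sum, totalBranches_eq_sum,
    ← (nodeEquiv a l r).sum_comp, Fintype.sum_sum_type, Fintype.sum_sum_type]
  -- With `c` saying that the child has the label of the new root, the first sum counts the topmost
  -- nodes of the child that remain topmost in the larger tree.
  have key : ∀ (t : BinaryTree Unit) (c : Prop) [Decidable c],
      (∑ p : Node t, if p.top = p ∧ ¬ (p = .root t ∧ c) then 1 else 0) + (if c then 1 else 0) =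
        ∑ p : Node t, if p.top = p then 1 else 0 := by
    intro t c _
    have : (if c then 1 else 0) = ∑ p : Node t, if p = .root t ∧ c then 1 else 0 := by
      rw [Fintype.sum_eq_single (Node.root t)]
      · simp
      · intro p hp; simp [hp]
    rw [this, ← Finset.sum_add_distrib]
    refine Finset.sum_congr rfl fun p _ => ?_
    by_cases hp : p = .root t
    · subst hp
      have : (Node.root t).top = .root t := rfl
      by_cases hc : c <;> simp [hc, this]
    · simp [hp]
  have hL : ∀ p : Node l, ((nodeEquiv a l r (.inr (.inl p))).top = nodeEquiv a l r (.inr (.inl p)))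
      ↔ (p.top = p ∧ ¬ (p = .root l ∧ reg l = reg (.node a l r))) := by
    intro p
    change (Node.left p : Node (.node a l r)).top = .left p ↔ _
    rw [Node.top_left]
    split_ifs with h
    · constructor
      · intro h'; cases h'
      · rintro ⟨h1, h2⟩
        exact absurd ⟨h1 ▸ h.1, h.2⟩ h2
    · constructor
      · intro h'
        have h' : p.top = p := by injection h'
        exact ⟨h', fun hh => h ⟨h'.trans hh.1, hh.2⟩⟩
      · rintro ⟨h1, -⟩
        rw [h1]
  have hR : ∀ p : Node r, ((nodeEquiv a l r (.inr (.inr p))).top = nodeEquiv a l r (.inr (.inr p)))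
      ↔ (p.top = p ∧ ¬ (p = .root r ∧ reg r = reg (.node a l r))) := by
    intro p
    change (Node.right p : Node (.node a l r)).top = .right p ↔ _
    rw [Node.top_right]
    split_ifs with h
    · constructor
      · intro h'; cases h'
      · rintro ⟨h1, h2⟩
        exact absurd ⟨h1 ▸ h.1, h.2⟩ h2
    · constructor
      · intro h'
        have h' : p.top = p := by injection h'
        exact ⟨h', fun hh => h ⟨h'.trans hh.1, hh.2⟩⟩
      · rintro ⟨h1, -⟩
        rw [h1]
  simp only [hL, hR]
  have h0 : (nodeEquiv a l r (.inl ())).top = nodeEquiv a l r (.inl ()) := rfl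
  have k1 := key l (reg l = reg (.node a l r))
  have k2 := key r (reg r = reg (.node a l r))
  -- Either the registers agree and both are below the new label, or exactly one child, the one with
  -- larger register, keeps the label.
  have k3 : (if reg l = reg (.node a l r) then 1 else 0) + (if reg r = reg (.node a l r) then 1 else 0)
      + (if reg l = reg r then 1 else 0) = 1 := by
    rw [reg]
    split_ifs <;> omega
  rw [← k1, ← k2]
  simp only [Finset.univ_unique, Finset.sum_singleton]
  rw [if_pos h0]
  omega

end TreeBranches

namespace TreeBranches

open BinaryTree

/-! ### Generating functions -/

/-- The generating function of a weight on binary trees, with respect to the size. -/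
noncomputable def treeSeries (w : BinaryTree Unit → ℚ) : PowerSeries ℚ :=
  PowerSeries.mk fun n => ∑ t ∈ treesOfNumNodesEq n, w t

theorem sum_treesOfNumNodesEq_succ (w : BinaryTree Unit → ℚ) (n : ℕ) :
    ∑ t ∈ treesOfNumNodesEq (n + 1), w t = ∑ ij ∈ Finset.HasAntidiagonal.antidiagonal n,
      ∑ l ∈ treesOfNumNodesEq ij.1, ∑ r ∈ treesOfNumNodesEq ij.2, w (.node () l r) := by
  rw [treesOfNumNodesEq_succ, Finset.sum_biUnion]
  · refine Finset.sum_congr rfl fun ij _ => ?_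
    rw [Finset.sum_map, Finset.sum_product]
    rfl
  · simp_rw [Set.PairwiseDisjoint, Set.Pairwise, Finset.disjoint_left]
    aesop

/-- The symbolic method: a weight that splits over the two subtrees as a sum of products yields a
functional equation. All generating function identities below are instances. -/
theorem treeSeries_eq {ι : Type*} (s : Finset ι) (w : BinaryTree Unit → ℚ)
    (f g : ι → BinaryTree Unit → ℚ)
    (h : ∀ l r, w (.node () l r) = ∑ i ∈ s, f i l * g i r) :
    treeSeries w = PowerSeries.C (w .nil) +
      PowerSeries.X * ∑ i ∈ s, treeSeries (f i) * treeSeries (g i) := by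
  ext n
  rcases n with _ | n
  · simp [treeSeries]
  · rw [map_add, PowerSeries.coeff_succ_X_mul, PowerSeries.coeff_succ_C, zero_add, map_sum,
      treeSeries, PowerSeries.coeff_mk, sum_treesOfNumNodesEq_succ]
    simp_rw [h, PowerSeries.coeff_mul, treeSeries, PowerSeries.coeff_mk, Finset.sum_mul_sum]
    rw [Finset.sum_comm]
    refine Finset.sum_congr rfl fun ij _ => ?_
    rw [Finset.sum_comm]
    simp_rw [Finset.sum_comm (s := s)]
    rw [Finset.sum_comm]

/-- The generating function of all binary trees. -/
noncomputable def catSeries : PowerSeries ℚ := treeSeries fun _ => 1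

/-- The generating function of the binary trees with register function `r`. -/
noncomputable def regSeries (r : ℕ) : PowerSeries ℚ := treeSeries fun t => if reg t = r then 1 else 0

theorem catSeries_eq : catSeries = 1 + PowerSeries.X * catSeries ^ 2 := by
  have := treeSeries_eq (Finset.univ : Finset Unit) (fun _ => 1) (fun _ _ => 1) (fun _ _ => 1)
    (by simp)
  simpa [catSeries, sq] using this

theorem reg_node_pos (a : Unit) (l r : BinaryTree Unit) : 0 < reg (.node a l r) := by
  rw [reg]; split_ifs <;> omega

theorem regSeries_zero : regSeries 0 = 1 := by
  have := treeSeries_eq (∅ : Finset Unit) (fun t => if reg t = 0 then 1 else 0) (fun _ _ => 1)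
    (fun _ _ => 1) (by intro l r; simp [(reg_node_pos () l r).ne'])
  simpa [regSeries, reg] using this

theorem sum_regSeries (r : ℕ) :
    ∑ j ∈ Finset.range r, regSeries j = treeSeries fun t => if reg t < r then 1 else 0 := by
  ext n
  simp only [map_sum, regSeries, treeSeries, PowerSeries.coeff_mk]
  rw [Finset.sum_comm]
  refine Finset.sum_congr rfl fun t _ => ?_
  rw [Finset.sum_ite_eq]
  simp

theorem regSeries_succ (r : ℕ) : regSeries (r + 1) = PowerSeries.X * (regSeries r ^ 2 +
    2 * (regSeries (r + 1) * ∑ j ∈ Finset.range (r + 1), regSeries j)) := by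
  have := treeSeries_eq (Finset.univ : Finset (Fin 3)) (fun t => if reg t = r + 1 then 1 else 0)
    ![fun t => if reg t = r then 1 else 0, fun t => if reg t = r + 1 then 1 else 0,
      fun t => if reg t < r + 1 then 1 else 0]
    ![fun t => if reg t = r then 1 else 0, fun t => if reg t < r + 1 then 1 else 0,
      fun t => if reg t = r + 1 then 1 else 0] (by
        intro s t
        rw [reg]
        simp only [Fin.sum_univ_three, Matrix.cons_val_zero, Matrix.cons_val_one, Matrix.cons_val]
        simp only [mul_ite, mul_one, mul_zero]
        split_ifs <;> first | omega | simp)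
  simp only [Fin.sum_univ_three, Matrix.cons_val_zero, Matrix.cons_val_one, Matrix.cons_val] at this
  rw [sum_regSeries]
  simp only [regSeries]
  refine this.trans ?_
  rw [if_neg (by simp [reg]), map_zero]
  ring

/-- The number of branches of `t` whose label is at most `K`. -/
def branchesUpTo (K : ℕ) : BinaryTree Unit → ℚ
  | .nil => 1
  | .node _ l r => branchesUpTo K l + branchesUpTo K r +
      if reg l = reg r ∧ reg l < K then 1 else 0

/-- The cutoff `K` keeps the sums over `r` finite at the level of power series. By `reg_le_numNodes`
it has no effect on trees of size at most `K`. -/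
theorem branchesUpTo_eq {K : ℕ} {t : BinaryTree Unit} (h : reg t ≤ K) :
    branchesUpTo K t = totalBranches t := by
  induction t with
  | nil => simp [branchesUpTo, totalBranches_nil]
  | node a l r hl hr =>
    rw [branchesUpTo, totalBranches_node]
    have h' : reg l ≤ K ∧ reg r ≤ K ∧ (reg l = reg r → reg l < K) := by
      rw [reg] at h; split_ifs at h <;> omega
    rw [hl h'.1, hr h'.2.1]
    push_cast
    congr 1
    by_cases hc : reg l = reg r
    · rw [if_pos ⟨hc, h'.2.2 hc⟩, if_pos hc]
    · rw [if_neg (fun hh => hc hh.1), if_neg hc]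

theorem reg_le_numNodes (t : BinaryTree Unit) : reg t ≤ t.numNodes := by
  induction t with
  | nil => simp [reg]
  | node a l r hl hr =>
    rw [reg, BinaryTree.numNodes]
    split_ifs <;> omega

theorem treeSeries_branchesUpTo (K : ℕ) : treeSeries (branchesUpTo K) =
    1 + PowerSeries.X * (2 * catSeries * treeSeries (branchesUpTo K) +
      ∑ r ∈ Finset.range K, regSeries r ^ 2) := by
  have := treeSeries_eq (Finset.disjSum (Finset.univ : Finset (Fin 2)) (Finset.range K))
    (branchesUpTo K)
    (Sum.elim ![branchesUpTo K, fun _ => 1] fun r t => if reg t = r then 1 else 0)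
    (Sum.elim ![fun _ => 1, branchesUpTo K] fun r t => if reg t = r then 1 else 0) (by
      intro l r
      rw [Finset.sum_disjSum, branchesUpTo]
      simp only [Sum.elim_inl, Sum.elim_inr, Fin.sum_univ_two, Matrix.cons_val_zero,
        Matrix.cons_val_one, mul_one, one_mul, mul_ite, mul_zero]
      congr 1
      by_cases h : reg l = reg r ∧ reg l < K
      · rw [if_pos h, Finset.sum_eq_single (reg l)]
        · simp [h.1]
        · intro b _ hb; rw [if_neg (Ne.symm hb)]; simp
        · intro hh; exact absurd (Finset.mem_range.2 h.2) hh
      · rw [if_neg h, Finset.sum_eq_zero]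
        intro b hb
        rw [Finset.mem_range] at hb
        split_ifs <;> first | omega | rfl)
  rw [Finset.sum_disjSum] at this
  simp only [Sum.elim_inl, Sum.elim_inr, Fin.sum_univ_two, Matrix.cons_val_zero,
        Matrix.cons_val_one] at this
  simp only [branchesUpTo, map_one, ← sq] at this
  simp only [catSeries, regSeries]
  linear_combination this

/-- The series `u` with `z = u / (1 + u) ^ 2`. -/
noncomputable def uSeries : PowerSeries ℚ := catSeries - 1

/-- The series `1 / √(1 - 4 z)`. -/
noncomputable def rootSeries : PowerSeries ℚ := (1 - 2 * PowerSeries.X * catSeries)⁻¹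

/-! ### Closed forms in the variable `u`. -/

theorem catSeries_eq_one_add : catSeries = 1 + uSeries := by rw [uSeries]; ring

theorem X_mul_catSeries_sq : PowerSeries.X * catSeries ^ 2 = uSeries := by
  rw [uSeries]; linear_combination -catSeries_eq

theorem constantCoeff_uSeries : PowerSeries.constantCoeff uSeries = 0 := by
  rw [← X_mul_catSeries_sq]; simp

theorem rootSeries_mul : rootSeries * (1 - 2 * PowerSeries.X * catSeries) = 1 :=
  PowerSeries.inv_mul_cancel _ (by simp)

theorem catSeries_ne_zero : catSeries ≠ 0 := by
  intro h
  have := congrArg PowerSeries.constantCoeff catSeries_eq_one_add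
  rw [h] at this
  simp [constantCoeff_uSeries] at this

theorem rootSeries_mul_one_sub : rootSeries * (1 - uSeries) = catSeries := by
  linear_combination catSeries * rootSeries_mul + 2 * rootSeries * X_mul_catSeries_sq
    - rootSeries * catSeries_eq_one_add

/-- Multiplying `u = z (1 + u)²` by `rootSeries * u^m` gives Pascal's rule applied twice. For `m =
0` the term with `u⁻¹` is replaced through the symmetry of the binomial coefficients, which gives
`rootSeries = 1 + 2z rootSeries (1 + u)`. -/
theorem coeff_rootSeries_mul_pow (n m : ℕ) :
    PowerSeries.coeff n (rootSeries * uSeries ^ m) = ((2 * n).choose (n + m) : ℚ) := by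
  induction n generalizing m with
  | zero =>
    have h0 : PowerSeries.constantCoeff rootSeries = 1 := by
      have := congrArg PowerSeries.constantCoeff rootSeries_mul_one_sub
      simpa [constantCoeff_uSeries, catSeries_eq_one_add] using this
    rcases m with _ | m
    · simp [h0]
    · simp [constantCoeff_uSeries]
  | succ n ih =>
    have e : 2 * (n + 1) = 2 * n + 1 + 1 := by ring
    rcases m with _ | m
    · have h : rootSeries * uSeries ^ 0 = 1 + PowerSeries.X * (2 * (rootSeries * uSeries ^ 0) +
          2 * (rootSeries * uSeries ^ 1)) := by
        linear_combination rootSeries_mul + 2 * PowerSeries.X * rootSeries * catSeries_eq_one_add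
      rw [h, map_add, PowerSeries.coeff_succ_X_mul, PowerSeries.coeff_one, if_neg (by omega),
        map_add, ← map_ofNat (PowerSeries.C (R := ℚ)) 2, PowerSeries.coeff_C_mul,
        PowerSeries.coeff_C_mul, ih, ih, e]
      have h1 : (2 * n + 1).choose n = (2 * n + 1).choose (n + 1) :=
        Nat.choose_symm_of_eq_add (by ring)
      rw [add_zero, add_zero, Nat.choose_succ_succ, h1, Nat.choose_succ_succ (2 * n) n]
      push_cast
      ring
    · have h : rootSeries * uSeries ^ (m + 1) = PowerSeries.X * (rootSeries * uSeries ^ (m + 2) +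
          2 * (rootSeries * uSeries ^ (m + 1)) + rootSeries * uSeries ^ m) := by
        have h1 := X_mul_catSeries_sq
        rw [catSeries_eq_one_add] at h1
        linear_combination -rootSeries * uSeries ^ m * h1
      rw [h, PowerSeries.coeff_succ_X_mul, map_add, map_add,
        ← map_ofNat (PowerSeries.C (R := ℚ)) 2, PowerSeries.coeff_C_mul, ih, ih, ih, e,
        show n + 1 + (m + 1) = n + m + 1 + 1 by ring, Nat.choose_succ_succ,
        Nat.choose_succ_succ (2 * n), Nat.choose_succ_succ (2 * n)]
      simp only [Nat.succ_eq_add_one, show n + (m + 2) = n + m + 1 + 1 by ring,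
        show n + (m + 1) = n + m + 1 by ring]
      push_cast
      ring

/-- The two formulas are proved jointly. The register recursion reads `R_{r+1} (1 - 2z ∑_{j ≤ r}
R_j) = z R_r²`, so the closed form of the partial sum is needed to solve for the next series.
Everything is kept free of division. -/
theorem regSeries_closed (r : ℕ) :
    regSeries r * (1 - uSeries ^ 2 ^ (r + 1)) * uSeries = (1 - uSeries ^ 2) * uSeries ^ 2 ^ r ∧
    catSeries * (1 - uSeries ^ 2 ^ r) *
      (1 - 2 * PowerSeries.X * ∑ j ∈ Finset.range r, regSeries j) =
        (1 - uSeries) * (1 + uSeries ^ 2 ^ r) := by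
  have hu : (1 - uSeries ^ 2 : PowerSeries ℚ) ≠ 0 := by
    intro h
    have := congrArg PowerSeries.constantCoeff h
    simp [constantCoeff_uSeries] at this
  induction r with
  | zero =>
    constructor
    · rw [regSeries_zero]; simp
    · rw [catSeries_eq_one_add]; simp; ring
  | succ r ih =>
    obtain ⟨h1, h2⟩ := ih
    have hp : ∀ k, uSeries ^ 2 ^ (k + 1) = (uSeries ^ 2 ^ k) ^ 2 := fun k => by
      rw [← pow_mul, pow_succ 2]
    rw [hp] at h1
    have h4 : catSeries * (1 - uSeries ^ 2 ^ (r + 1)) *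
      (1 - 2 * PowerSeries.X * ∑ j ∈ Finset.range (r + 1), regSeries j) =
        (1 - uSeries) * (1 + uSeries ^ 2 ^ (r + 1)) := by
      apply mul_left_cancel₀ catSeries_ne_zero
      rw [Finset.sum_range_succ, hp]
      linear_combination catSeries * (1 + uSeries ^ 2 ^ r) * h2 - 2 * h1
        + (1 - uSeries) * ((1 + uSeries ^ 2 ^ r) ^ 2 - (1 + (uSeries ^ 2 ^ r) ^ 2))
          * catSeries_eq_one_add
        - 2 * (1 - (uSeries ^ 2 ^ r) ^ 2) * regSeries r * X_mul_catSeries_sq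
    refine ⟨?_, h4⟩
    have h5 : regSeries (r + 1) *
        (1 - 2 * PowerSeries.X * ∑ j ∈ Finset.range (r + 1), regSeries j) =
        PowerSeries.X * regSeries r ^ 2 := by
      linear_combination regSeries_succ r
    apply mul_left_cancel₀ hu
    rw [hp (r + 1), hp r] at *
    generalize uSeries ^ 2 ^ r = x at *
    generalize ∑ j ∈ Finset.range (r + 1), regSeries j = L at *
    linear_combination (-(1 - x ^ 2) * catSeries * uSeries * regSeries (r + 1)) * h4
      + (catSeries ^ 2 * (1 - x ^ 2) ^ 2 * uSeries) * h5
      + (regSeries r * (1 - x ^ 2) * uSeries + (1 - uSeries ^ 2) * x) * h1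
      + regSeries r ^ 2 * (1 - x ^ 2) ^ 2 * uSeries * X_mul_catSeries_sq
      - (1 - x ^ 2) * (1 + x ^ 2) * uSeries * regSeries (r + 1) * (1 - uSeries)
        * catSeries_eq_one_add

/-- The generating function of the number of `r`-branches. -/
noncomputable def branchSeries : ℕ → PowerSeries ℚ
  | 0 => rootSeries
  | r + 1 => rootSeries * (PowerSeries.X * regSeries r ^ 2)

/-- The linear equation for the branch series is solved by multiplying with `rootSeries = (1 -
2zT)⁻¹`. The constant `1` accounts for the leaves, and `z R_r²` for the lowest nodes of the
`(r+1)`-branches. -/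
theorem treeSeries_branchesUpTo_eq_sum (K : ℕ) :
    treeSeries (branchesUpTo K) = ∑ r ∈ Finset.range (K + 1), branchSeries r := by
  rw [Finset.sum_range_succ']
  simp only [branchSeries]
  rw [← Finset.mul_sum, ← Finset.mul_sum]
  linear_combination rootSeries * treeSeries_branchesUpTo K -
    treeSeries (branchesUpTo K) * rootSeries_mul

theorem uSeries_ne_zero : uSeries ≠ 0 := by
  rw [← X_mul_catSeries_sq]
  exact mul_ne_zero PowerSeries.X_ne_zero (pow_ne_zero _ catSeries_ne_zero)

theorem branchSeries_mul (r : ℕ) : branchSeries r * (1 - uSeries ^ 2 ^ r) ^ 2 =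
    rootSeries * (1 - uSeries) ^ 2 * uSeries ^ (2 ^ r - 1) := by
  apply mul_right_cancel₀ uSeries_ne_zero
  rw [mul_assoc _ (uSeries ^ _), ← pow_succ, Nat.sub_add_cancel Nat.one_le_two_pow]
  rcases r with _ | r
  · simp [branchSeries]
  · apply mul_left_cancel₀ (pow_ne_zero 2 catSeries_ne_zero)
    have h1 := (regSeries_closed r).1
    have hp : uSeries ^ 2 ^ (r + 1) = (uSeries ^ 2 ^ r) ^ 2 := by
      rw [← pow_mul, pow_succ 2]
    rw [branchSeries, hp]
    rw [hp] at h1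
    generalize uSeries ^ 2 ^ r = x at *
    linear_combination rootSeries * uSeries * (1 - x ^ 2) ^ 2 * regSeries r ^ 2 * X_mul_catSeries_sq
      + rootSeries * (regSeries r * (1 - x ^ 2) * uSeries + (1 - uSeries ^ 2) * x) * h1
      - rootSeries * (1 - uSeries) ^ 2 * x ^ 2 * (catSeries + 1 + uSeries) * catSeries_eq_one_add

theorem one_sub_sq_mul_sum {R : Type*} [CommRing R] (x : R) (K : ℕ) :
    (1 - x) ^ 2 * ∑ k ∈ Finset.range K, ((k : R) + 1) * x ^ k =
      1 - x ^ K * ((K : R) + 1 - K * x) := by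
  induction K with
  | zero => simp
  | succ K ih =>
    rw [Finset.sum_range_succ, mul_add, ih]
    push_cast
    ring

/-- Expand `1 / (1 - u^(2^r))²` as `∑ (k + 1) u^(k 2^r)`. The factor `(1 - u)²` produces the second
difference. The natural subtraction is genuine because `(k + 1) 2^r ≥ 1`. -/
theorem coeff_branchSeries {n K : ℕ} (h : n < K) (r : ℕ) :
    PowerSeries.coeff n (branchSeries r) = ∑ k ∈ Finset.range K, ((k : ℚ) + 1) *
      (((2 * n).choose (n + ((k + 1) * 2 ^ r - 1)) : ℚ) - 2 * (2 * n).choose (n + (k + 1) * 2 ^ r) +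
        (2 * n).choose (n + ((k + 1) * 2 ^ r + 1))) := by
  set x := uSeries ^ 2 ^ r with hx
  have h1 : branchSeries r = ∑ k ∈ Finset.range K, PowerSeries.C ((k : ℚ) + 1) *
      (rootSeries * uSeries ^ ((k + 1) * 2 ^ r - 1) - PowerSeries.C 2 *
        (rootSeries * uSeries ^ ((k + 1) * 2 ^ r)) +
        rootSeries * uSeries ^ ((k + 1) * 2 ^ r + 1)) +
      x ^ K * (branchSeries r * ((K : PowerSeries ℚ) + 1 - K * x)) := by
    have h2 : ∑ k ∈ Finset.range K, PowerSeries.C ((k : ℚ) + 1) *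
      (rootSeries * uSeries ^ ((k + 1) * 2 ^ r - 1) - PowerSeries.C 2 *
        (rootSeries * uSeries ^ ((k + 1) * 2 ^ r)) +
        rootSeries * uSeries ^ ((k + 1) * 2 ^ r + 1)) =
        branchSeries r * ((1 - x) ^ 2 *
          ∑ k ∈ Finset.range K, ((k : PowerSeries ℚ) + 1) * x ^ k) := by
      rw [← mul_assoc, branchSeries_mul, Finset.mul_sum]
      refine Finset.sum_congr rfl fun k _ => ?_
      have e : (k + 1) * 2 ^ r = (2 ^ r - 1) + 2 ^ r * k + 1 := by
        have := Nat.one_le_two_pow (n := r)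
        rw [add_mul, mul_comm k]; omega
      rw [e, Nat.add_sub_cancel, hx]
      simp only [map_add, map_natCast, map_one, map_ofNat]
      rw [pow_succ _ (_ + 1), pow_succ, pow_add, pow_mul]
      ring
    rw [h2, one_sub_sq_mul_sum]
    ring
  -- Since `u` has no constant term, the remainder after `K` terms starts at `z^K` and does not
  -- affect the coefficient of `z^n` for `n < K`.
  have h3 : (PowerSeries.X : PowerSeries ℚ) ^ K ∣
      x ^ K * (branchSeries r * ((K : PowerSeries ℚ) + 1 - K * x)) := by
    refine Dvd.dvd.mul_right (pow_dvd_pow_of_dvd ?_ _) _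
    rw [hx]
    refine dvd_pow ?_ (by positivity)
    exact PowerSeries.X_dvd_iff.2 constantCoeff_uSeries
  rw [h1, map_add, PowerSeries.X_pow_dvd_iff.1 h3 n h, add_zero, map_sum]
  refine Finset.sum_congr rfl fun k _ => ?_
  rw [PowerSeries.coeff_C_mul, map_add, map_sub, PowerSeries.coeff_C_mul, coeff_rootSeries_mul_pow,
    coeff_rootSeries_mul_pow, coeff_rootSeries_mul_pow]

theorem sum_totalBranches {n K : ℕ} (h : n < K) :
    ∑ t ∈ treesOfNumNodesEq n, (totalBranches t : ℚ) =
      ∑ r ∈ Finset.range (K + 1), PowerSeries.coeff n (branchSeries r) := by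
  rw [← map_sum, ← treeSeries_branchesUpTo_eq_sum, treeSeries, PowerSeries.coeff_mk]
  refine Finset.sum_congr rfl fun t ht => ?_
  rw [branchesUpTo_eq]
  have := reg_le_numNodes t
  rw [mem_treesOfNumNodesEq.1 ht] at this
  omega

end TreeBranches

namespace TreeBranches

open BinaryTree

/-! ### The expected number of branches as a sum over binomial coefficients -/

/-- The quotient of the binomial coefficient at distance `m` from the centre by the central one. -/
noncomputable def relChoose (N m : ℕ) : ℝ := ((2 * N).choose (N + m) : ℝ) / (2 * N).choose N

/-- The weight of `m` in the expected number of branches. -/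
noncomputable def branchWeight (N m : ℕ) : ℝ := (4 * (m : ℝ) ^ 2 / N - 2) * relChoose N m

theorem relChoose_eq_zero {N m : ℕ} (h : N < m) : relChoose N m = 0 := by
  rw [relChoose, Nat.choose_eq_zero_of_lt (by omega)]; simp

theorem choose_mul_eq (n m : ℕ) :
    ((2 * n).choose (n + m) : ℝ) * ((2 * n + 2) * (2 * n + 1)) =
      ((2 * (n + 1)).choose (n + 1 + m) : ℝ) * (((n : ℝ) + 1) ^ 2 - m ^ 2) := by
  rcases le_or_gt m (n + 1) with h | h
  · have h1 := Nat.add_one_mul_choose_eq (2 * n + 1) (n + m)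
    have h2 := Nat.choose_mul_succ_eq (2 * n) (n + m)
    have h3 : 2 * n + 1 - (n + m) = n + 1 - m := by omega
    rw [h3] at h2
    have e1 : 2 * (n + 1) = (2 * n + 1).succ := by simp; ring
    have e2 : n + 1 + m = (n + m).succ := by simp; ring
    rw [e1, e2]
    have h1' : ((2 * n + 1 : ℝ) + 1) * ((2 * n + 1).choose (n + m) : ℝ) =
      ((2 * n + 1).succ.choose (n + m).succ : ℝ) * (n + m + 1) := by exact_mod_cast h1
    have h2' : ((2 * n).choose (n + m) : ℝ) * (2 * n + 1) =
        ((2 * n + 1).choose (n + m) : ℝ) * ((n : ℝ) + 1 - m) := by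
      have : ((n + 1 - m : ℕ) : ℝ) = (n : ℝ) + 1 - m := by push_cast [h]; ring
      rw [← this]; exact_mod_cast h2
    linear_combination (2 * n + 2 : ℝ) * h2' + ((n : ℝ) + 1 - m) * h1'
  · rw [Nat.choose_eq_zero_of_lt (by omega), Nat.choose_eq_zero_of_lt (by omega)]
    simp

/-- With `N = n + 1`, Pascal's rule twice turns the second difference into `C(2N, N+m) - 4 C(2n,
n+m)`, and `choose_mul_eq` reduces the last coefficient to the first. This is why the size enters as
`n + 1` from here on. -/
theorem branchWeight_mul_catalan (n : ℕ) {m : ℕ} (hm : 0 < m) :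
    branchWeight (n + 1) m * catalan n =
      ((2 * n).choose (n + (m - 1)) : ℝ) - 2 * (2 * n).choose (n + m) +
        (2 * n).choose (n + (m + 1)) := by
  obtain ⟨m, rfl⟩ : ∃ l, m = l + 1 := ⟨m - 1, by omega⟩
  have hp : ((2 * (n + 1)).choose (n + 1 + (m + 1)) : ℝ) = ((2 * n).choose (n + m) : ℝ) +
      2 * (2 * n).choose (n + m + 1) + (2 * n).choose (n + m + 1 + 1) := by
    rw [show 2 * (n + 1) = 2 * n + 1 + 1 by ring, show n + 1 + (m + 1) = n + m + 1 + 1 by ring,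
        Nat.choose_succ_succ,
        Nat.choose_succ_succ (2 * n), Nat.choose_succ_succ (2 * n)]
    push_cast
    ring
  have h1 := choose_mul_eq n (m + 1)
  have h2 : ((n : ℝ) + 1) * catalan n = (2 * n).choose n := by
    exact_mod_cast succ_mul_catalan_eq_centralBinom n
  have h3 : ((n : ℝ) + 1) * (2 * (n + 1)).choose (n + 1) = 2 * (2 * n + 1) * (2 * n).choose n := by
    exact_mod_cast Nat.succ_mul_centralBinom_succ n
  have h0 : ((2 * (n + 1)).choose (n + 1) : ℝ) ≠ 0 := by
    exact_mod_cast (Nat.choose_pos (by omega)).ne'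
  rw [branchWeight, relChoose]
  simp only [Nat.add_sub_cancel, ← add_assoc] at *
  push_cast at *
  have hn : (n : ℝ) + 1 ≠ 0 := by positivity
  have hn2 : 2 * (n : ℝ) + 1 ≠ 0 := by positivity
  have hn3 : (2 * (n : ℝ) + 2) ≠ 0 := by positivity
  have h4 : (catalan n : ℝ) = ((2 * (n + 1)).choose (n + 1) : ℝ) / (2 * (2 * n + 1)) := by
    field_simp
    apply mul_left_cancel₀ hn
    linear_combination (2 * (2 * n + 1) : ℝ) * h2 - h3
  have h5 : ((2 * n).choose (n + m + 1) : ℝ) = ((2 * (n + 1)).choose (n + 1 + m + 1) : ℝ) *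
      (((n : ℝ) + 1) ^ 2 - (m + 1) ^ 2) / ((2 * n + 2) * (2 * n + 1)) := by
    field_simp
    linear_combination h1
  have h6 : ((2 * n).choose (n + m) : ℝ) + (2 * n).choose (n + m + 1 + 1) =
    ((2 * (n + 1)).choose (n + 1 + m + 1) : ℝ) - 2 * (2 * n).choose (n + m + 1) := by
    linear_combination -hp
  have h7 : ((2 * n).choose (n + m) : ℝ) - 2 * (2 * n).choose (n + m + 1) +
      (2 * n).choose (n + m + 1 + 1) =
    ((2 * (n + 1)).choose (n + 1 + m + 1) : ℝ) - 4 * (2 * n).choose (n + m + 1) := by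
    linear_combination h6
  rw [h7, h5, h4]
  field_simp
  ring

theorem branchWeight_eq_zero {N m : ℕ} (h : N < m) : branchWeight N m = 0 := by
  rw [branchWeight, relChoose_eq_zero h, mul_zero]

/-- Both series are finite sums in disguise, because the weight vanishes once `(k + 1) 2^r > n + 1`.
-/
theorem expectedBranches_eq_tsum (n : ℕ) :
    expectedBranches n =
      ∑' r : ℕ, ∑' k : ℕ, ((k : ℝ) + 1) * branchWeight (n + 1) ((k + 1) * 2 ^ r) := by
  have hin : ∀ r : ℕ, ∑' k : ℕ, ((k : ℝ) + 1) * branchWeight (n + 1) ((k + 1) * 2 ^ r) =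
      ∑ k ∈ Finset.range (n + 1), ((k : ℝ) + 1) * branchWeight (n + 1) ((k + 1) * 2 ^ r) := by
    intro r
    refine tsum_eq_sum fun k hk => ?_
    rw [Finset.mem_range, not_lt] at hk
    rw [branchWeight_eq_zero, mul_zero]
    calc n + 1 < k + 1 := by omega
      _ ≤ (k + 1) * 2 ^ r := Nat.le_mul_of_pos_right _ (by positivity)
  simp_rw [hin]
  rw [tsum_eq_sum (s := Finset.range (n + 1 + 1))]
  · have hc : (catalan n : ℝ) ≠ 0 := by
      have := succ_mul_catalan_eq_centralBinom n
      have h2 := Nat.centralBinom_pos n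
      rw [← this] at h2
      exact_mod_cast (Nat.pos_of_mul_pos_left h2).ne'
    rw [expectedBranches, treesOfNumNodesEq_card_eq_catalan, div_eq_iff hc]
    have h := sum_totalBranches (Nat.lt_succ_self n)
    simp_rw [coeff_branchSeries (Nat.lt_succ_self n)] at h
    have h' := congrArg (Rat.cast : ℚ → ℝ) h
    push_cast at h'
    rw [h', Finset.sum_mul]
    refine Finset.sum_congr rfl fun r _ => ?_
    rw [Finset.sum_mul]
    refine Finset.sum_congr rfl fun k _ => ?_
    rw [mul_assoc, branchWeight_mul_catalan n (by positivity)]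
  · intro r hr
    rw [Finset.mem_range, not_lt] at hr
    refine Finset.sum_eq_zero fun k _ => ?_
    rw [branchWeight_eq_zero, mul_zero]
    calc n + 1 < 2 ^ r := lt_of_lt_of_le (by omega) (Nat.lt_two_pow_self (n := r)).le
      _ ≤ (k + 1) * 2 ^ r := Nat.le_mul_of_pos_left _ (by positivity)

end TreeBranches

namespace TreeBranches

/-! ### Gaussian approximation of binomial coefficients -/

theorem log_one_add_sub_log_one_sub_ge {t : ℝ} (h0 : 0 ≤ t) (h1 : t < 1) :
    2 * (t + t ^ 3 / 3) ≤ Real.log (1 + t) - Real.log (1 - t) := by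
  have h := Real.hasSum_log_sub_log_of_abs_lt_one (x := t) (by rwa [abs_of_nonneg h0])
  have h2 := sum_le_hasSum (Finset.range 2) (fun i _ => by positivity) h
  norm_num [Finset.sum_range_succ] at h2
  linarith

theorem log_one_add_sub_log_one_sub_le {t : ℝ} (h0 : 0 ≤ t) (h1 : t ≤ 1 / 2) :
    Real.log (1 + t) - Real.log (1 - t) ≤ 2 * (t + t ^ 3 / 3 + t ^ 5) := by
  have h := Real.hasSum_log_sub_log_of_abs_lt_one (x := t) (by rw [abs_of_nonneg h0]; linarith)
  have ht : t ^ 2 ≤ 1 / 4 := by nlinarith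
  have h2 := (hasSum_nat_add_iff' 2).2 h
  -- For `t ≤ 1/2` the series from the fifth power on is dominated by a geometric series of ratio
  -- `1/4`, with sum `4/3 t⁵ ≤ 2 t⁵`.
  have h3 : HasSum (fun n : ℕ => t ^ 5 * (1 / 4 : ℝ) ^ n) (t ^ 5 * (1 - 1 / 4)⁻¹) :=
    (hasSum_geometric_of_lt_one (by norm_num) (by norm_num)).mul_left _
  have h4 := hasSum_le (fun n => ?_) h2 h3
  · norm_num [Finset.sum_range_succ] at h4
    have : 0 ≤ t ^ 5 := by positivity
    linarith
  · have e : t ^ (2 * (n + 2) + 1) = t ^ 5 * (t ^ 2) ^ n := by ring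
    rw [e]
    have hp : (t ^ 2) ^ n ≤ (1 / 4) ^ n := by gcongr
    have hc : 2 * (1 / (2 * ((n + 2 : ℕ) : ℝ) + 1)) ≤ 1 := by
      rw [← mul_div_assoc, div_le_one (by positivity)]
      push_cast
      have : (0 : ℝ) ≤ n := by positivity
      linarith
    calc 2 * (1 / (2 * ((n + 2 : ℕ) : ℝ) + 1)) * (t ^ 5 * (t ^ 2) ^ n)
        ≤ 1 * (t ^ 5 * (1 / 4) ^ n) := by gcongr
      _ = _ := one_mul _

theorem relChoose_zero (N : ℕ) : relChoose N 0 = 1 := by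
  rw [relChoose, add_zero, div_self]
  exact_mod_cast (Nat.choose_pos (by omega)).ne'

theorem relChoose_succ (N m : ℕ) :
    relChoose N (m + 1) = relChoose N m * (((N : ℝ) - m) / (N + m + 1)) := by
  rcases le_or_gt m N with h | h
  · have h1 := Nat.choose_succ_right_eq (2 * N) (N + m)
    rw [show 2 * N - (N + m) = N - m by omega] at h1
    have h2 : ((2 * N).choose (N + m + 1) : ℝ) * (N + m + 1) =
        (2 * N).choose (N + m) * ((N : ℝ) - m) := by
      rw [← Nat.cast_sub h]; exact_mod_cast h1
    have : ((N : ℝ) + m + 1) ≠ 0 := by positivity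
    rw [relChoose, relChoose, ← add_assoc, eq_div_of_mul_eq this h2]
    ring
  · rw [relChoose_eq_zero h, relChoose_eq_zero (by omega), zero_mul]

theorem relChoose_pos {N m : ℕ} (h : m ≤ N) : 0 < relChoose N m := by
  have h1 := Nat.choose_pos (show N + m ≤ 2 * N by omega)
  have h2 := Nat.choose_pos (show N ≤ 2 * N by omega)
  rw [relChoose]
  positivity

/-- The ratio `(N - m) / (N + m + 1)` is `(1 - t) / (1 + t)` with `t = (m + 1/2) / (N + 1/2)`. Its
logarithm is odd in `t`, so even powers drop out; this explains the choice `M = N + 1/2`. -/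
theorem log_relChoose_succ {N m : ℕ} (h : m + 1 ≤ N) :
    Real.log (relChoose N (m + 1)) = Real.log (relChoose N m) -
      (Real.log (1 + ((m : ℝ) + 1 / 2) / (N + 1 / 2)) -
        Real.log (1 - ((m : ℝ) + 1 / 2) / (N + 1 / 2))) := by
  have h' : (m : ℝ) + 1 ≤ N := by exact_mod_cast h
  have hM : (0 : ℝ) < N + 1 / 2 := by positivity
  have e1 : 1 + ((m : ℝ) + 1 / 2) / (N + 1 / 2) = ((N : ℝ) + m + 1) / (N + 1 / 2) := by
    field_simp; ring
  have e2 : 1 - ((m : ℝ) + 1 / 2) / (N + 1 / 2) = ((N : ℝ) - m) / (N + 1 / 2) := by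
    field_simp; ring
  have hpos : (0 : ℝ) < (N : ℝ) - m := by linarith
  have hpos' : (0 : ℝ) < (N : ℝ) + m + 1 := by positivity
  rw [e1, e2, relChoose_succ, Real.log_mul (relChoose_pos (by omega)).ne' (by positivity),
    Real.log_div hpos.ne' hpos'.ne', Real.log_div hpos'.ne' hM.ne', Real.log_div hpos.ne' hM.ne']
  ring

/-- The right side is the sum over `j < m` of `-2 (t_j + t_j³ / 3)` with `t_j = (j + 1/2) / (N +
1/2)`, in closed form. -/
theorem log_relChoose_le {N m : ℕ} (h : m ≤ N) :
    Real.log (relChoose N m) ≤ -((m : ℝ) ^ 2 / (N + 1 / 2)) -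
      ((m : ℝ) ^ 4 / 6 - (m : ℝ) ^ 2 / 12) / ((N : ℝ) + 1 / 2) ^ 3 := by
  induction m with
  | zero => simp [relChoose_zero]
  | succ m ih =>
    have ih := ih (by omega)
    have h' : (m : ℝ) + 1 ≤ N := by exact_mod_cast h
    have hM : (0 : ℝ) < N + 1 / 2 := by positivity
    have h1 := log_one_add_sub_log_one_sub_ge (t := ((m : ℝ) + 1 / 2) / (N + 1 / 2))
      (by positivity) (by rw [div_lt_one hM]; linarith)
    rw [log_relChoose_succ h]
    push_cast
    have e : -(((m : ℝ) + 1) ^ 2 / (N + 1 / 2)) -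
      (((m : ℝ) + 1) ^ 4 / 6 - ((m : ℝ) + 1) ^ 2 / 12) / ((N : ℝ) + 1 / 2) ^ 3 =
      -((m : ℝ) ^ 2 / (N + 1 / 2)) -
      ((m : ℝ) ^ 4 / 6 - (m : ℝ) ^ 2 / 12) / ((N : ℝ) + 1 / 2) ^ 3 -
      2 * (((m : ℝ) + 1 / 2) / (N + 1 / 2) + (((m : ℝ) + 1 / 2) / (N + 1 / 2)) ^ 3 / 3) := by
      generalize (N : ℝ) + 1 / 2 = M at *
      field_simp
      ring
    rw [e]
    linarith

theorem log_relChoose_ge {N m : ℕ} (h : (m : ℝ) ≤ ((N : ℝ) + 1 / 2) / 2) :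
    -((m : ℝ) ^ 2 / (N + 1 / 2)) -
      ((m : ℝ) ^ 4 / 6 - (m : ℝ) ^ 2 / 12) / ((N : ℝ) + 1 / 2) ^ 3 -
        2 * (m : ℝ) ^ 6 / ((N : ℝ) + 1 / 2) ^ 5 ≤ Real.log (relChoose N m) := by
  induction m with
  | zero => simp [relChoose_zero]
  | succ m ih =>
    push_cast at h
    have ih := ih (by linarith)
    have hM : (0 : ℝ) < N + 1 / 2 := by positivity
    have hm : (0 : ℝ) ≤ m := by positivity
    have h' : m + 1 ≤ N := by
      have : (m : ℝ) < N := by linarith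
      exact_mod_cast this
    have h1 := log_one_add_sub_log_one_sub_le (t := ((m : ℝ) + 1 / 2) / (N + 1 / 2))
      (by positivity) (by rw [div_le_iff₀ hM]; linarith)
    rw [log_relChoose_succ h']
    push_cast
    have h2 : (m : ℝ) ^ 6 + (m + 1 / 2) ^ 5 ≤ ((m : ℝ) + 1) ^ 6 := by
      have : 0 ≤ ((m : ℝ) + 1) ^ 6 - (m : ℝ) ^ 6 - (m + 1 / 2) ^ 5 := by ring_nf; positivity
      linarith
    have h3 : 2 * ((m : ℝ) ^ 6 + (m + 1 / 2) ^ 5) / ((N : ℝ) + 1 / 2) ^ 5 ≤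
        2 * ((m : ℝ) + 1) ^ 6 / ((N : ℝ) + 1 / 2) ^ 5 := by gcongr
    have e : -(((m : ℝ) + 1) ^ 2 / (N + 1 / 2)) -
      (((m : ℝ) + 1) ^ 4 / 6 - ((m : ℝ) + 1) ^ 2 / 12) / ((N : ℝ) + 1 / 2) ^ 3 -
        2 * ((m : ℝ) ^ 6 + (m + 1 / 2) ^ 5) / ((N : ℝ) + 1 / 2) ^ 5 =
      -((m : ℝ) ^ 2 / (N + 1 / 2)) -
      ((m : ℝ) ^ 4 / 6 - (m : ℝ) ^ 2 / 12) / ((N : ℝ) + 1 / 2) ^ 3 -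
        2 * (m : ℝ) ^ 6 / ((N : ℝ) + 1 / 2) ^ 5 -
      2 * (((m : ℝ) + 1 / 2) / (N + 1 / 2) + (((m : ℝ) + 1 / 2) / (N + 1 / 2)) ^ 3 / 3 +
        (((m : ℝ) + 1 / 2) / (N + 1 / 2)) ^ 5) := by
      generalize (N : ℝ) + 1 / 2 = M at *
      field_simp
      ring
    linarith

theorem abs_exp_neg_sub_one_add_le {w : ℝ} (hw : 0 ≤ w) :
    |Real.exp (-w) - (1 - w)| ≤ w ^ 2 / 2 := by
  have h1 := Real.add_one_le_exp (-w)
  have h2 := Real.quadratic_le_exp_of_nonneg hw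
  have h3 : Real.exp (-w) ≤ 1 - w + w ^ 2 / 2 := by
    rw [Real.exp_neg]
    refine inv_le_of_inv_le₀ (by nlinarith [sq_nonneg (w - 1)]) (le_trans ?_ h2)
    rw [inv_le_iff_one_le_mul₀ (by nlinarith [sq_nonneg (w - 1)])]
    nlinarith [sq_nonneg (w ^ 2)]
  rw [abs_le]
  constructor <;> nlinarith [sq_nonneg w]

theorem abs_exp_sub_one_le_of_le_one {x : ℝ} (hx : x ≤ 1) : |Real.exp x - 1| ≤ 2 * |x| := by
  rcases le_or_gt (-1) x with h | h
  · exact Real.abs_exp_sub_one_le (abs_le.2 ⟨h, hx⟩)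
  · have h1 := Real.exp_pos x
    have h2 : Real.exp x ≤ 1 := Real.exp_le_one_iff.2 (by linarith)
    rw [abs_of_nonpos (by linarith), abs_of_neg (by linarith)]
    linarith

/-- For `m ≤ M/2` the logarithm is expanded and exponentiated. For larger `m` one has `v ≥ M/4`, so
the crude bound `e^{-v}` suffices: powers of `v` pay for the factor `1/M²`. -/
theorem abs_relChoose_sub_le {N m : ℕ} (hN : 0 < N) {M v : ℝ} (hM : M = N + 1 / 2)
    (hv : v = (m : ℝ) ^ 2 / M) :
    |relChoose N m - Real.exp (-v) * (1 - v ^ 2 / (6 * M))| ≤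
      40 * (v + v ^ 2 + v ^ 3 + v ^ 4) * Real.exp (-v) / M ^ 2 := by
  have hN1 : (1 : ℝ) ≤ N := by exact_mod_cast hN
  have hM0 : 0 < M := by rw [hM]; positivity
  have hM1 : 1 ≤ M := by linarith
  have hv0 : 0 ≤ v := by rw [hv]; positivity
  have hmv : (m : ℝ) ^ 2 = v * M := by rw [hv]; field_simp
  set w := v ^ 2 / (6 * M) with hw
  have hw0 : 0 ≤ w := by positivity
  have hE := Real.exp_pos (-v)
  have e4 : ((m : ℝ) ^ 4 / 6 - (m : ℝ) ^ 2 / 12) / M ^ 3 = w - v / (12 * M ^ 2) := by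
    rw [show (m : ℝ) ^ 4 = ((m : ℝ) ^ 2) ^ 2 by ring, hmv, hw]; field_simp
  have e6 : 2 * (m : ℝ) ^ 6 / M ^ 5 = 2 * v ^ 3 / M ^ 2 := by
    rw [show (m : ℝ) ^ 6 = ((m : ℝ) ^ 2) ^ 3 by ring, hmv]; field_simp
  rcases le_or_gt (m : ℝ) (M / 2) with h | h
  · have hmN : m ≤ N := by
      have : (m : ℝ) ≤ N := by linarith
      exact_mod_cast this
    have hlo := log_relChoose_ge (N := N) (m := m) (by rw [← hM]; exact h)
    have hup := log_relChoose_le hmN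
    rw [← hM, ← hv, e4] at hlo hup
    rw [e6] at hlo
    set ε := Real.log (relChoose N m) + v + w with hε
    have hp : relChoose N m = Real.exp (-v) * (Real.exp (-w) * Real.exp ε) := by
      rw [← Real.exp_add, ← Real.exp_add, hε,
        show -v + (-w + (Real.log (relChoose N m) + v + w)) = Real.log (relChoose N m) by ring,
        Real.exp_log (relChoose_pos hmN)]
    have hvM : v ≤ M := by
      rw [hv, div_le_iff₀ hM0]; nlinarith [(Nat.cast_nonneg m : (0 : ℝ) ≤ m)]
    have hε1 : ε ≤ v / (12 * M ^ 2) := by linarith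
    have hε2 : -(2 * v ^ 3 / M ^ 2) ≤ ε := by
      have : 0 ≤ v / (12 * M ^ 2) := by positivity
      linarith
    have hεle : ε ≤ 1 := by
      refine hε1.trans ?_
      rw [div_le_one (by positivity)]
      nlinarith
    have hεabs : |ε| ≤ (v + 2 * v ^ 3) / M ^ 2 := by
      rw [abs_le, add_div]
      have h1 : 0 ≤ v / M ^ 2 := by positivity
      have h2 : 0 ≤ 2 * v ^ 3 / M ^ 2 := by positivity
      have h3 : v / (12 * M ^ 2) ≤ v / M ^ 2 := by gcongr; nlinarith [sq_nonneg M]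
      constructor <;> linarith
    have hk : |Real.exp (-w) * Real.exp ε - (1 - w)| ≤ 2 * ((v + 2 * v ^ 3) / M ^ 2) + w ^ 2 / 2 := by
      have e : Real.exp (-w) * Real.exp ε - (1 - w) = Real.exp (-w) * (Real.exp ε - 1) +
        (Real.exp (-w) - (1 - w)) := by ring
      rw [e]
      refine (abs_add_le _ _).trans (add_le_add ?_ (abs_exp_neg_sub_one_add_le hw0))
      rw [abs_mul, abs_of_pos (Real.exp_pos _)]
      calc Real.exp (-w) * |Real.exp ε - 1| ≤ 1 * (2 * |ε|) := by
            gcongr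
            · exact Real.exp_le_one_iff.2 (by linarith)
            · exact abs_exp_sub_one_le_of_le_one hεle
        _ ≤ _ := by rw [one_mul]; gcongr
    rw [hp, ← mul_sub, abs_mul, abs_of_pos hE]
    calc Real.exp (-v) * |Real.exp (-w) * Real.exp ε - (1 - w)|
        ≤ Real.exp (-v) * (2 * ((v + 2 * v ^ 3) / M ^ 2) + w ^ 2 / 2) := by gcongr
      _ = ((2 * v + 4 * v ^ 3 + v ^ 4 / 72) * Real.exp (-v)) / M ^ 2 := by
        rw [hw]; field_simp; ring
      _ ≤ _ := by
        gcongr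
        nlinarith [pow_nonneg hv0 2, pow_nonneg hv0 3, pow_nonneg hv0 4]
  · have hvM : M / 4 ≤ v := by
      rw [hv, le_div_iff₀ hM0]; nlinarith
    have hp0 : 0 ≤ relChoose N m := by rw [relChoose]; positivity
    have hp : relChoose N m ≤ Real.exp (-v) := by
      rcases le_or_gt m N with hm | hm
      · have hup := log_relChoose_le hm
        rw [← hM, ← hv] at hup
        rw [← Real.exp_log (relChoose_pos hm)]
        refine Real.exp_le_exp.2 (hup.trans ?_)
        have : 0 ≤ ((m : ℝ) ^ 4 / 6 - (m : ℝ) ^ 2 / 12) / M ^ 3 := by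
          apply div_nonneg _ (by positivity)
          rcases Nat.eq_zero_or_pos m with h0 | h0
          · simp [h0]
          · have : (1 : ℝ) ≤ m := by exact_mod_cast h0
            nlinarith [sq_nonneg (m : ℝ), mul_self_nonneg ((m : ℝ) - 1)]
        linarith
      · rw [relChoose_eq_zero hm]; exact hE.le
    have hb : |relChoose N m - Real.exp (-v) * (1 - w)| ≤ (2 + w) * Real.exp (-v) := by
      rw [abs_le]
      constructor <;> nlinarith [mul_nonneg hw0 hE.le]
    refine hb.trans ?_
    rw [mul_div_right_comm]
    gcongr
    rw [le_div_iff₀ (by positivity), hw]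
    -- This costs `2 M² ≤ 32 v²`, which is where the constant `40` is needed.
    have h1 : M ^ 2 ≤ 16 * v ^ 2 := by nlinarith
    have h2 : v ^ 2 / (6 * M) * M ^ 2 = v ^ 2 * M / 6 := by field_simp
    rw [add_mul, h2]
    nlinarith [pow_nonneg hv0 2, pow_nonneg hv0 3, pow_nonneg hv0 4]

theorem pow_le_one_add_pow {v : ℝ} (hv : 0 ≤ v) {i j : ℕ} (h : i ≤ j) : v ^ i ≤ 1 + v ^ j := by
  rcases le_or_gt v 1 with h1 | h1
  · have := pow_le_one₀ (n := i) hv h1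
    have := pow_nonneg hv j
    linarith
  · have := pow_le_pow_right₀ h1.le h
    linarith

theorem exists_abs_branchWeight_sub_le : ∃ C : ℝ, 0 < C ∧ ∀ N m : ℕ, 0 < N → ∀ M v : ℝ,
    M = N + 1 / 2 → v = (m : ℝ) ^ 2 / M →
    |branchWeight N m - ((4 * v - 2) + (2 * v + v ^ 2 / 3 - 2 / 3 * v ^ 3) / M) * Real.exp (-v)| ≤
      C / M ^ 2 * ((1 + v ^ 5) * Real.exp (-v)) := by
  refine ⟨2000, by norm_num, fun N m hN M v hM hv => ?_⟩
  have hN1 : (1 : ℝ) ≤ N := by exact_mod_cast hN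
  have hM0 : 0 < M := by rw [hM]; positivity
  have hv0 : 0 ≤ v := by rw [hv]; positivity
  have hmv : (m : ℝ) ^ 2 = v * M := by rw [hv]; field_simp
  have h1 := abs_relChoose_sub_le hN hM hv (m := m)
  have hE := Real.exp_pos (-v)
  set D := relChoose N m - Real.exp (-v) * (1 - v ^ 2 / (6 * M)) with hD
  have hN0 : (0 : ℝ) < N := by linarith
  have hNM : (N : ℝ) = M - 1 / 2 := by linarith
  -- Here `4 m² / N = 4v M/N` and `M/N = 1 + 1/(2N)`. The term `2v/M` comes from this factor, and
  -- `v²/3 - 2v³/3` from `-(4v - 2) v² / 6`.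
  have e : branchWeight N m -
      ((4 * v - 2) + (2 * v + v ^ 2 / 3 - 2 / 3 * v ^ 3) / M) * Real.exp (-v) =
      (4 * v * (M / N) - 2) * D + Real.exp (-v) * (v / (N * M) - v ^ 3 / (3 * N * M)) := by
    rw [hD, branchWeight, hmv]
    field_simp
    rw [hNM]
    ring
  have hMN : M / N ≤ 3 / 2 := by rw [div_le_iff₀ hN0]; linarith
  have hMN0 : 0 < M / N := by positivity
  have hNM2 : 1 / (N * M) ≤ 3 / 2 / M ^ 2 := by
    rw [div_le_div_iff₀ (by positivity) (by positivity)]; nlinarith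
  have hP := mul_nonneg hv0 hMN0.le
  have hb1 : |4 * v * (M / N) - 2| ≤ 6 * v + 2 := by
    rw [abs_le]; constructor <;> nlinarith
  have hb2 : |v / (N * M) - v ^ 3 / (3 * N * M)| ≤ (v + v ^ 3) * (3 / 2 / M ^ 2) := by
    have e2 : v / (N * M) - v ^ 3 / (3 * N * M) = (v - v ^ 3 / 3) * (1 / (N * M)) := by
      field_simp
    rw [e2, abs_mul, abs_of_pos (show 0 < 1 / (N * M) by positivity)]
    gcongr
    rw [abs_le]
    constructor <;> nlinarith [pow_nonneg hv0 3]
  rw [e]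
  refine (abs_add_le _ _).trans ?_
  rw [abs_mul, abs_mul, abs_of_pos hE]
  calc |4 * v * (M / N) - 2| * |D| + Real.exp (-v) * |v / (N * M) - v ^ 3 / (3 * N * M)|
      ≤ (6 * v + 2) * (40 * (v + v ^ 2 + v ^ 3 + v ^ 4) * Real.exp (-v) / M ^ 2) +
        Real.exp (-v) * ((v + v ^ 3) * (3 / 2 / M ^ 2)) := by gcongr
    _ = ((6 * v + 2) * (40 * (v + v ^ 2 + v ^ 3 + v ^ 4)) + 3 / 2 * (v + v ^ 3)) *
        (Real.exp (-v) / M ^ 2) := by ring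
    _ ≤ (2000 * (1 + v ^ 5)) * (Real.exp (-v) / M ^ 2) := by
      gcongr
      have := pow_le_one_add_pow hv0 (show 1 ≤ 5 by norm_num)
      have := pow_le_one_add_pow hv0 (show 2 ≤ 5 by norm_num)
      have := pow_le_one_add_pow hv0 (show 3 ≤ 5 by norm_num)
      have := pow_le_one_add_pow hv0 (show 4 ≤ 5 by norm_num)
      nlinarith
    _ = _ := by ring

end TreeBranches

namespace TreeBranches

open MeasureTheory Set Filter Topology

/-! ### Euler–Maclaurin summation -/

/-- Four integrations by parts against the kernel `y² (1 - y)² / 24`, `y = x - a`. Its fourth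
derivative is `1`, it vanishes to second order at both ends, and it is at most `1` in between. -/
theorem abs_integral_sub_trapezoid_le {f f₁ f₂ f₃ f₄ : ℝ → ℝ}
    (h₀ : ∀ x, HasDerivAt f (f₁ x) x) (h₁ : ∀ x, HasDerivAt f₁ (f₂ x) x)
    (h₂ : ∀ x, HasDerivAt f₂ (f₃ x) x) (h₃ : ∀ x, HasDerivAt f₃ (f₄ x) x)
    (h₄ : Continuous f₄) (a : ℝ) :
    |(∫ x in a..a + 1, f x) - (f a + f (a + 1)) / 2 + (f₁ (a + 1) - f₁ a) / 12| ≤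
      ∫ x in a..a + 1, |f₄ x| := by
  have hc : Continuous f := continuous_iff_continuousAt.2 fun x => (h₀ x).continuousAt
  set w : ℝ → ℝ := fun x => (x - a) ^ 2 * (1 - (x - a)) ^ 2 / 24 with hw
  have hwc : Continuous w := by fun_prop
  have hIntegral : ∫ x in a..a + 1, (w x * f₄ x - f x) =
      (f₁ (a + 1) - f₁ a) / 12 - (f a + f (a + 1)) / 2 := by
    have hd : ∀ x ∈ uIcc a (a + 1), HasDerivAt (fun x =>
        w x * f₃ x - (2 * (x - a) - 6 * (x - a) ^ 2 + 4 * (x - a) ^ 3) / 24 * f₂ x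
        + (2 - 12 * (x - a) + 12 * (x - a) ^ 2) / 24 * f₁ x - (-12 + 24 * (x - a)) / 24 * f x)
        (w x * f₄ x - f x) x := by
      intro x _
      have hx : HasDerivAt (fun x : ℝ => x - a) 1 x := (hasDerivAt_id x).sub_const a
      have hw' : HasDerivAt w ((2 * (x - a) - 6 * (x - a) ^ 2 + 4 * (x - a) ^ 3) / 24) x := by
        have := ((hx.pow 2).mul ((hx.const_sub 1).pow 2)).div_const 24
        refine this.congr_deriv ?_
        simp
        ring
      have hw2 : HasDerivAt (fun x => (2 * (x - a) - 6 * (x - a) ^ 2 + 4 * (x - a) ^ 3) / 24)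
          ((2 - 12 * (x - a) + 12 * (x - a) ^ 2) / 24) x := by
        have := (((hx.const_mul 2).sub ((hx.pow 2).const_mul 6)).add
          ((hx.pow 3).const_mul 4)).div_const 24
        refine this.congr_deriv ?_
        simp
        ring
      have hw3 : HasDerivAt (fun x => (2 - 12 * (x - a) + 12 * (x - a) ^ 2) / 24)
          ((-12 + 24 * (x - a)) / 24) x := by
        have := (((hx.const_mul 12).const_sub 2).add ((hx.pow 2).const_mul 12)).div_const 24
        refine this.congr_deriv ?_
        simp
        ring
      have hw4 : HasDerivAt (fun x => (-12 + 24 * (x - a)) / 24) 1 x := by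
        have := ((hx.const_mul 24).const_add (-12)).div_const 24
        refine this.congr_deriv ?_
        simp
      have := (((hw'.mul (h₃ x)).sub (hw2.mul (h₂ x))).add (hw3.mul (h₁ x))).sub (hw4.mul (h₀ x))
      refine this.congr_deriv ?_
      ring
    rw [intervalIntegral.integral_eq_sub_of_hasDerivAt hd
      (((hwc.mul h₄).sub hc).intervalIntegrable _ _)]
    simp only [hw]
    ring_nf
  rw [intervalIntegral.integral_sub (f := fun x => w x * f₄ x)
    ((hwc.mul h₄).intervalIntegrable _ _) (hc.intervalIntegrable _ _)] at hIntegral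
  have e : (∫ x in a..a + 1, f x) - (f a + f (a + 1)) / 2 + (f₁ (a + 1) - f₁ a) / 12 =
      ∫ x in a..a + 1, w x * f₄ x := by linarith
  rw [e]
  refine (intervalIntegral.abs_integral_le_integral_abs (by linarith)).trans ?_
  refine intervalIntegral.integral_mono_on (by linarith)
    ((hwc.mul h₄).abs.intervalIntegrable _ _) (h₄.abs.intervalIntegrable _ _) fun x hx => ?_
  rw [abs_mul]
  refine mul_le_of_le_one_left (abs_nonneg _) ?_
  have h1 : 0 ≤ x - a := by linarith [hx.1]
  have h2 : x - a ≤ 1 := by linarith [hx.2]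
  rw [hw, abs_of_nonneg (by positivity)]
  have h3 : (x - a) ^ 2 ≤ 1 := by nlinarith
  have h4 : (1 - (x - a)) ^ 2 ≤ 1 := by nlinarith
  have := mul_le_one₀ h3 (by positivity) h4
  linarith

/-- Summing over unit intervals telescopes the derivative terms. Integrability of a function and of
its derivative forces the boundary terms at infinity to vanish. -/
theorem abs_integral_sub_tsum_le {f f₁ f₂ f₃ f₄ : ℝ → ℝ}
    (h₀ : ∀ x, HasDerivAt f (f₁ x) x) (h₁ : ∀ x, HasDerivAt f₁ (f₂ x) x)
    (h₂ : ∀ x, HasDerivAt f₂ (f₃ x) x) (h₃ : ∀ x, HasDerivAt f₃ (f₄ x) x)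
    (h₄ : Continuous f₄) (hf : IntegrableOn f (Ioi 0)) (hf₁ : IntegrableOn f₁ (Ioi 0))
    (hf₂ : IntegrableOn f₂ (Ioi 0)) (hf₄ : IntegrableOn f₄ (Ioi 0))
    (hs : Summable fun k : ℕ => f (k + 1)) :
    |(∫ x in Ioi 0, f x) - (∑' k : ℕ, f (k + 1)) - f 0 / 2 - f₁ 0 / 12| ≤
      ∫ x in Ioi 0, |f₄ x| := by
  have hc : Continuous f := continuous_iff_continuousAt.2 fun x => (h₀ x).continuousAt
  have hn : ∀ n : ℕ, |(∫ x in (0 : ℝ)..n, f x) - (∑ k ∈ Finset.range n, f (k + 1)) -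
      (f 0 - f n) / 2 + (f₁ n - f₁ 0) / 12| ≤ ∫ x in (0 : ℝ)..n, |f₄ x| := by
    intro n
    induction n with
    | zero => simp
    | succ n ih =>
      have h := abs_integral_sub_trapezoid_le h₀ h₁ h₂ h₃ h₄ n
      rw [Finset.sum_range_succ]
      push_cast
      rw [← intervalIntegral.integral_add_adjacent_intervals (hc.intervalIntegrable 0 n)
        (hc.intervalIntegrable n (n + 1)), ← intervalIntegral.integral_add_adjacent_intervals
        (h₄.abs.intervalIntegrable 0 n) (h₄.abs.intervalIntegrable n (n + 1))]
      refine le_trans (le_of_eq ?_) ((abs_add_le _ _).trans (add_le_add ih h))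
      congr 1
      ring
  have hle : ∀ n : ℕ, ∫ x in (0 : ℝ)..n, |f₄ x| ≤ ∫ x in Ioi 0, |f₄ x| := by
    intro n
    rw [intervalIntegral.integral_of_le (by positivity)]
    exact setIntegral_mono_set hf₄.abs (Eventually.of_forall fun x => abs_nonneg _)
      (Eventually.of_forall fun x hx => hx.1)
  have t0 := (tendsto_zero_of_hasDerivAt_of_integrableOn_Ioi (a := 0) (fun x _ => h₀ x) hf₁ hf).comp
    tendsto_natCast_atTop_atTop
  have t1 := (tendsto_zero_of_hasDerivAt_of_integrableOn_Ioi (a := 0) (fun x _ => h₁ x) hf₂ hf₁).comp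
    tendsto_natCast_atTop_atTop
  have ti := intervalIntegral_tendsto_integral_Ioi (μ := volume) 0 hf
    (tendsto_natCast_atTop_atTop (R := ℝ))
  have ts := hs.hasSum.tendsto_sum_nat
  have key := (((ti.sub ts).sub ((t0.const_sub (f 0)).div_const 2)).add
    ((t1.sub_const (f₁ 0)).div_const 12)).abs
  have := le_of_tendsto key (Eventually.of_forall fun n => (hn n).trans (hle n))
  refine le_trans (le_of_eq ?_) this
  congr 1
  ring

/-! ### Polynomials times a Gaussian -/

/-- The derivative of `P e^{-x²}` is `Q e^{-x²}` for `Q = gaussDeriv P`. -/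
noncomputable def gaussDeriv (P : Polynomial ℝ) : Polynomial ℝ :=
  Polynomial.derivative P - Polynomial.C 2 * Polynomial.X * P

/-- The function `P e^{-x²}` for a polynomial `P`. -/
noncomputable def polyGauss (P : Polynomial ℝ) (x : ℝ) : ℝ := P.eval x * Real.exp (-x ^ 2)

theorem hasDerivAt_polyGauss (P : Polynomial ℝ) (x : ℝ) :
    HasDerivAt (polyGauss P) (polyGauss (gaussDeriv P) x) x := by
  have h := (P.hasDerivAt x).mul (((hasDerivAt_id x).pow 2).neg.exp)
  refine h.congr_deriv ?_
  simp [polyGauss, gaussDeriv]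
  ring

theorem continuous_polyGauss (P : Polynomial ℝ) : Continuous (polyGauss P) := by
  unfold polyGauss; fun_prop

theorem integrableOn_polyGauss (P : Polynomial ℝ) : IntegrableOn (polyGauss P) (Ioi 0) := by
  induction P using Polynomial.induction_on' with
  | add p q hp hq =>
    refine (hp.add hq).congr_fun (fun x _ => ?_) measurableSet_Ioi
    simp [polyGauss, add_mul]
  | monomial n a =>
    have h := (integrableOn_rpow_mul_exp_neg_mul_sq (b := 1) one_pos (s := n)
      (by have : (0 : ℝ) ≤ n := by positivity
          linarith)).const_mul a
    refine IntegrableOn.congr_fun h (fun x _ => ?_) measurableSet_Ioi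
    simp [polyGauss, mul_assoc]

theorem integral_polyGauss_X_pow (j : ℕ) :
    ∫ x in Ioi 0, polyGauss (Polynomial.X ^ (2 * j + 1)) x = j.factorial / 2 := by
  have h := integral_rpow_mul_exp_neg_rpow (p := 2) (q := (2 * j + 1 : ℕ)) (by norm_num)
    (by have : (0 : ℝ) ≤ ((2 * j + 1 : ℕ) : ℝ) := by positivity
        linarith)
  have e : ((((2 * j + 1 : ℕ) : ℝ) + 1) / 2) = j + 1 := by push_cast; ring
  rw [e, Real.Gamma_nat_eq_factorial] at h
  rw [show (j.factorial : ℝ) / 2 = 1 / 2 * j.factorial by ring, ← h]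
  refine setIntegral_congr_fun measurableSet_Ioi fun x _ => ?_
  simp only [polyGauss, Polynomial.eval_pow, Polynomial.eval_X, Real.rpow_natCast]
  norm_num

/-! ### The sums `∑ k (k² t)^j e^{-k² t}` -/

/-- The function `∑_{k ≥ 1} k (k² t)^j e^{-k² t}`. -/
noncomputable def expSum (j : ℕ) (t : ℝ) : ℝ :=
  ∑' k : ℕ, ((k : ℝ) + 1) * ((((k : ℝ) + 1) ^ 2 * t) ^ j * Real.exp (-(((k : ℝ) + 1) ^ 2 * t)))

theorem pow_mul_exp_neg_le {u : ℝ} (hu : 0 ≤ u) (j : ℕ) :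
    u ^ j * Real.exp (-u) ≤ j.factorial := by
  have h := Real.pow_div_factorial_le_exp u hu j
  rw [Real.exp_neg, ← div_eq_mul_inv, div_le_iff₀ (Real.exp_pos u)]
  rwa [div_le_iff₀ (by positivity), mul_comm] at h

theorem expSum_term_le (j : ℕ) {t : ℝ} (ht : 0 < t) (k : ℕ) :
    ((k : ℝ) + 1) * ((((k : ℝ) + 1) ^ 2 * t) ^ j * Real.exp (-(((k : ℝ) + 1) ^ 2 * t))) ≤
      (j + 2).factorial / t ^ 2 * (1 / (((k + 1 : ℕ) : ℝ)) ^ 3) := by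
  have h := pow_mul_exp_neg_le (u := ((k : ℝ) + 1) ^ 2 * t) (by positivity) (j + 2)
  have hk : (0 : ℝ) < (k : ℝ) + 1 := by positivity
  push_cast
  rw [div_mul_div_comm, mul_one, le_div_iff₀ (by positivity)]
  refine le_trans (le_of_eq ?_) h
  ring

theorem summable_one_div_succ_cube : Summable fun k : ℕ => 1 / (((k + 1 : ℕ) : ℝ)) ^ 3 :=
  (summable_nat_add_iff 1).2 (Real.summable_one_div_nat_pow.2 (by norm_num))

theorem summable_expSum (j : ℕ) {t : ℝ} (ht : 0 < t) : Summable fun k : ℕ =>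
    ((k : ℝ) + 1) * ((((k : ℝ) + 1) ^ 2 * t) ^ j * Real.exp (-(((k : ℝ) + 1) ^ 2 * t))) :=
  Summable.of_nonneg_of_le (fun k => by positivity) (expSum_term_le j ht)
    (summable_one_div_succ_cube.mul_left _)

theorem expSum_nonneg (j : ℕ) {t : ℝ} (ht : 0 < t) : 0 ≤ expSum j t :=
  tsum_nonneg fun k => by positivity

theorem exists_expSum_le_div_sq (j : ℕ) : ∃ C : ℝ, 0 ≤ C ∧ ∀ t : ℝ, 0 < t → expSum j t ≤ C / t ^ 2 := by
  refine ⟨(j + 2).factorial * ∑' k : ℕ, 1 / (((k + 1 : ℕ) : ℝ)) ^ 3,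
    mul_nonneg (by positivity) (tsum_nonneg fun k => by positivity), fun t ht => ?_⟩
  refine ((summable_expSum j ht).tsum_le_tsum (expSum_term_le j ht)
    (summable_one_div_succ_cube.mul_left _)).trans (le_of_eq ?_)
  rw [tsum_mul_left]
  ring

theorem continuousOn_expSum (j : ℕ) : ContinuousOn (expSum j) (Ioi 0) := by
  intro t₀ ht₀
  have h : ContinuousOn (expSum j) (Ioi (t₀ / 2)) := by
    have hpos : (0 : ℝ) < t₀ / 2 := half_pos ht₀
    refine continuousOn_tsum (u := fun k : ℕ => (j + 2).factorial / (t₀ / 2) ^ 2 *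
      (1 / (((k + 1 : ℕ) : ℝ)) ^ 3)) (fun k => by fun_prop)
      (summable_one_div_succ_cube.mul_left _) fun k t ht => ?_
    have ht' : t₀ / 2 < t := ht
    have ht0 : 0 < t := hpos.trans ht'
    rw [Real.norm_of_nonneg (by positivity)]
    refine (expSum_term_le j ht0 k).trans ?_
    gcongr
  exact (h.continuousAt (Ioi_mem_nhds (half_lt_self ht₀))).continuousWithinAt

/-- Euler–Maclaurin for `x ↦ P(√t x) e^{-t x²} / √t` with `P = X^(2j+1)`. The integral is `j! /
(2t)`, the derivative at `0` is nonzero only for `j = 0`, and the remainder scales as `(√t)⁴ / √t /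
√t = t`. -/
theorem exists_abs_expSum_sub_le (j : ℕ) : ∃ C : ℝ, 0 ≤ C ∧ ∀ t : ℝ, 0 < t →
    |expSum j t - j.factorial / 2 / t + (if j = 0 then 1 else 0) / 12| ≤ C * t := by
  set P : Polynomial ℝ := Polynomial.X ^ (2 * j + 1) with hP
  refine ⟨∫ x in Ioi 0, |polyGauss (gaussDeriv (gaussDeriv (gaussDeriv (gaussDeriv P)))) x|,
    integral_nonneg fun x => abs_nonneg _, fun t ht => ?_⟩
  set a := √t with ha
  have ha0 : 0 < a := Real.sqrt_pos.2 ht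
  have hat : a ^ 2 = t := Real.sq_sqrt ht.le
  have hd : ∀ (i : ℕ) (Q : Polynomial ℝ) (x : ℝ), HasDerivAt
      (fun x => a ^ i / a * polyGauss Q (a * x))
      (a ^ (i + 1) / a * polyGauss (gaussDeriv Q) (a * x)) x := by
    intro i Q x
    have h := (hasDerivAt_polyGauss Q (a * x)).comp x ((hasDerivAt_id x).const_mul a)
    have h' := h.const_mul (a ^ i / a)
    refine h'.congr_deriv ?_
    simp
    ring
  have hIntegral : ∀ (i : ℕ) (Q : Polynomial ℝ), IntegrableOn
      (fun x => a ^ i / a * polyGauss Q (a * x)) (Ioi 0) := by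
    intro i Q
    refine Integrable.const_mul ?_ _
    have := (integrableOn_Ioi_comp_mul_left_iff (polyGauss Q) 0 ha0).2
      (by rw [mul_zero]; exact integrableOn_polyGauss Q)
    exact this
  have hterm : ∀ k : ℕ, a ^ 0 / a * polyGauss P (a * ((k : ℝ) + 1)) =
      ((k : ℝ) + 1) * ((((k : ℝ) + 1) ^ 2 * t) ^ j * Real.exp (-(((k : ℝ) + 1) ^ 2 * t))) := by
    intro k
    simp only [polyGauss, hP, Polynomial.eval_pow, Polynomial.eval_X, pow_zero]
    rw [show -(a * ((k : ℝ) + 1)) ^ 2 = -(((k : ℝ) + 1) ^ 2 * t) by rw [← hat]; ring, ← hat,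
      show ((k : ℝ) + 1) ^ 2 * a ^ 2 = (a * ((k : ℝ) + 1)) ^ 2 by ring, ← pow_mul, pow_succ]
    field_simp
  have h := abs_integral_sub_tsum_le (hd 0 P) (hd 1 _) (hd 2 _) (hd 3 _)
    (by have := continuous_polyGauss (gaussDeriv (gaussDeriv (gaussDeriv (gaussDeriv P))))
        fun_prop) (hIntegral 0 _) (hIntegral 1 _) (hIntegral 2 _) (hIntegral 4 _)
    (by simp_rw [hterm]; exact summable_expSum j ht)
  simp_rw [hterm] at h
  have e0 : a ^ 0 / a * polyGauss P (a * 0) = 0 := by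
    simp [polyGauss, hP]
  have e1 : a ^ (0 + 1) / a * polyGauss (gaussDeriv P) (a * 0) = if j = 0 then 1 else 0 := by
    rw [zero_add, pow_one, div_self ha0.ne']
    rcases j with _ | j
    · simp [polyGauss, gaussDeriv, hP]
    · simp [polyGauss, gaussDeriv, hP]
  have ei : ∫ x in Ioi 0, a ^ 0 / a * polyGauss P (a * x) = j.factorial / 2 / t := by
    rw [integral_const_mul, integral_comp_mul_left_Ioi (polyGauss P) 0 ha0, mul_zero,
      integral_polyGauss_X_pow, ← hat]
    simp only [smul_eq_mul]
    field_simp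
  have e4 : ∫ x in Ioi 0, |a ^ (3 + 1) / a *
      polyGauss (gaussDeriv (gaussDeriv (gaussDeriv (gaussDeriv P)))) (a * x)| =
      (∫ x in Ioi 0, |polyGauss (gaussDeriv (gaussDeriv (gaussDeriv (gaussDeriv P)))) x|) * t := by
    simp_rw [abs_mul]
    rw [integral_const_mul, integral_comp_mul_left_Ioi (fun x => |polyGauss _ x|) 0 ha0, mul_zero,
      abs_of_pos (by positivity), ← hat]
    simp only [smul_eq_mul]
    field_simp
  rw [e0, e1, ei, e4] at h
  refine le_trans (le_of_eq ?_) h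
  rw [← abs_neg, expSum]
  congr 1
  ring

end TreeBranches

namespace TreeBranches

open MeasureTheory Set Filter Topology Asymptotics

/-! ### The Mellin transform of the harmonic sum -/

/-- The function `∑_{k ≥ 1} k (4 k² t - 2) e^{-k² t}`. -/
noncomputable def brSum (t : ℝ) : ℝ := 4 * expSum 1 t - 2 * expSum 0 t

/-- The orders `j = 1` and `j = 0` combine to `2/t - 1/t + 1/6`. -/
theorem exists_abs_brSum_sub_le : ∃ C : ℝ, 0 ≤ C ∧ ∀ t : ℝ, 0 < t →
    |brSum t - 1 / t - 1 / 6| ≤ C * t := by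
  obtain ⟨C₀, h₀, h₀'⟩ := exists_abs_expSum_sub_le 0
  obtain ⟨C₁, h₁, h₁'⟩ := exists_abs_expSum_sub_le 1
  refine ⟨4 * C₁ + 2 * C₀, by positivity, fun t ht => ?_⟩
  have a := h₀' t ht
  have b := h₁' t ht
  simp only [Nat.factorial, if_true, one_ne_zero, if_false] at a b
  have e : brSum t - 1 / t - 1 / 6 = 4 * (expSum 1 t - ((1 * 1 : ℕ) : ℝ) / 2 / t + 0 / 12) -
      2 * (expSum 0 t - ((1 : ℕ) : ℝ) / 2 / t + 1 / 12) := by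
    rw [brSum]; push_cast; ring
  rw [e, abs_le]
  rw [abs_le] at a b
  norm_num at a b ⊢
  constructor <;> linarith [a.1, a.2, b.1, b.2]

theorem exists_abs_brSum_le : ∃ C : ℝ, 0 ≤ C ∧ ∀ t : ℝ, 0 < t → |brSum t| ≤ C / t ^ 2 := by
  obtain ⟨C₀, h₀, h₀'⟩ := exists_expSum_le_div_sq 0
  obtain ⟨C₁, h₁, h₁'⟩ := exists_expSum_le_div_sq 1
  refine ⟨4 * C₁ + 2 * C₀, by positivity, fun t ht => ?_⟩
  have a := h₀' t ht
  have b := h₁' t ht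
  have a' := expSum_nonneg 0 ht
  have b' := expSum_nonneg 1 ht
  rw [brSum, abs_le, add_div, mul_div_assoc, mul_div_assoc]
  constructor <;> linarith

theorem continuousOn_brSum : ContinuousOn brSum (Ioi 0) :=
  ((continuousOn_expSum 1).const_mul 4).sub ((continuousOn_expSum 0).const_mul 2)

/-- The function `brSum`, regularised at zero. -/
noncomputable def brSumReg (t : ℝ) : ℂ :=
  (brSum t : ℂ) - (indicator (Ioc 0 1) (fun t : ℝ => (t : ℂ) ^ (-1 : ℂ)) t +
    (1 / 6 : ℂ) • indicator (Ioc 0 1) (fun _ => (1 : ℂ)) t)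

theorem brSumReg_of_le {t : ℝ} (h0 : 0 < t) (h1 : t ≤ 1) :
    brSumReg t = ((brSum t - 1 / t - 1 / 6 : ℝ) : ℂ) := by
  have h : t ∈ Ioc (0 : ℝ) 1 := ⟨h0, h1⟩
  rw [brSumReg, indicator_of_mem h, indicator_of_mem h, Complex.cpow_neg_one]
  push_cast
  simp only [smul_eq_mul]
  ring

theorem brSumReg_of_lt {t : ℝ} (h1 : 1 < t) : brSumReg t = (brSum t : ℂ) := by
  have : t ∉ Ioc (0 : ℝ) 1 := fun h => absurd h.2 (not_le.2 h1)
  rw [brSumReg, indicator_of_notMem this, indicator_of_notMem this]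
  simp

theorem isBigO_brSumReg_top : brSumReg =O[atTop] (· ^ (-(2 : ℝ)) : ℝ → ℝ) := by
  obtain ⟨C, _, h⟩ := exists_abs_brSum_le
  refine IsBigO.of_bound C ?_
  filter_upwards [eventually_gt_atTop 1] with t ht
  have ht0 : 0 < t := by linarith
  rw [brSumReg_of_lt ht, Complex.norm_real, Real.norm_eq_abs, Real.norm_of_nonneg (by positivity),
    Real.rpow_neg ht0.le, ← div_eq_mul_inv]
  exact_mod_cast h t ht0

theorem isBigO_brSumReg_zero : brSumReg =O[𝓝[>] 0] (· ^ (-(-1 : ℝ)) : ℝ → ℝ) := by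
  obtain ⟨C, _, h⟩ := exists_abs_brSum_sub_le
  refine IsBigO.of_bound C ?_
  filter_upwards [Ioc_mem_nhdsGT (zero_lt_one (α := ℝ))] with t ht
  rw [brSumReg_of_le ht.1 ht.2, Complex.norm_real, Real.norm_eq_abs, neg_neg, Real.rpow_one,
    Real.norm_of_nonneg ht.1.le]
  exact h t ht.1

theorem locallyIntegrableOn_ofReal_comp {f : ℝ → ℝ} (hf : ContinuousOn f (Ioi 0)) :
    LocallyIntegrableOn (fun t => (f t : ℂ)) (Ioi 0) :=
  (Complex.continuous_ofReal.comp_continuousOn hf).locallyIntegrableOn measurableSet_Ioi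

theorem locallyIntegrableOn_brSumReg : LocallyIntegrableOn brSumReg (Ioi 0) := by
  have h1 : LocallyIntegrableOn (fun t : ℝ => (t : ℂ) ^ (-1 : ℂ)) (Ioi 0) := by
    refine ContinuousOn.locallyIntegrableOn (fun t ht => ?_) measurableSet_Ioi
    simp_rw [Complex.cpow_neg_one]
    exact (Complex.continuous_ofReal.continuousAt.inv₀
      (Complex.ofReal_ne_zero.2 (ne_of_gt ht))).continuousWithinAt
  have h2 : LocallyIntegrableOn (fun _ : ℝ => (1 : ℂ)) (Ioi 0) :=
    continuousOn_const.locallyIntegrableOn measurableSet_Ioi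
  have hi : ∀ f : ℝ → ℂ, LocallyIntegrableOn f (Ioi 0) →
      LocallyIntegrableOn (indicator (Ioc 0 1) f) (Ioi 0) := by
    intro f hf t ht
    obtain ⟨u, hu, hfu⟩ := hf t ht
    exact ⟨u, hu, hfu.indicator measurableSet_Ioc⟩
  exact (locallyIntegrableOn_ofReal_comp continuousOn_brSum).sub
    ((hi _ h1).add ((hi _ h2).smul (1 / 6 : ℂ)))

theorem isBigO_expSum_top (j : ℕ) :
    (fun t => (expSum j t : ℂ)) =O[atTop] (· ^ (-(2 : ℝ)) : ℝ → ℝ) := by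
  obtain ⟨C, _, h⟩ := exists_expSum_le_div_sq j
  refine IsBigO.of_bound C ?_
  filter_upwards [eventually_gt_atTop 0] with t ht0
  rw [Complex.norm_real, Real.norm_of_nonneg (expSum_nonneg j ht0),
    Real.norm_of_nonneg (by positivity), Real.rpow_neg ht0.le, ← div_eq_mul_inv]
  exact_mod_cast h t ht0

theorem exists_expSum_le_div (j : ℕ) : ∃ C : ℝ, 0 ≤ C ∧ ∀ t : ℝ, 0 < t → expSum j t ≤ C / t := by
  obtain ⟨C, hC, h⟩ := exists_abs_expSum_sub_le j
  obtain ⟨D, hD, h'⟩ := exists_expSum_le_div_sq j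
  refine ⟨C + D + j.factorial / 2, by positivity, fun t ht => ?_⟩
  rcases le_or_gt t 1 with h1 | h1
  · have h2 := (abs_le.1 (h t ht)).2
    have h3 : (0 : ℝ) ≤ (if j = 0 then 1 else 0) / 12 := by split_ifs <;> norm_num
    have h4 : C * t ≤ C / t := by
      rw [le_div_iff₀ ht, mul_assoc]
      exact mul_le_of_le_one_right hC (by nlinarith)
    have h5 : 0 ≤ D / t := by positivity
    rw [add_div, add_div]
    linarith
  · refine (h' t ht).trans ?_
    rw [div_le_div_iff₀ (by positivity) ht]
    have h6 : (0 : ℝ) ≤ j.factorial / 2 := by positivity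
    have h7 : t ≤ t ^ 2 := by nlinarith
    calc D * t ≤ D * t ^ 2 := by gcongr
      _ ≤ _ := by gcongr; linarith

theorem isBigO_expSum_zero (j : ℕ) :
    (fun t => (expSum j t : ℂ)) =O[𝓝[>] 0] (· ^ (-(1 : ℝ)) : ℝ → ℝ) := by
  obtain ⟨C, _, h⟩ := exists_expSum_le_div j
  refine IsBigO.of_bound C ?_
  filter_upwards [self_mem_nhdsWithin] with t ht0
  have ht0 : 0 < t := ht0
  rw [Complex.norm_real, Real.norm_of_nonneg (expSum_nonneg j ht0),
    Real.norm_of_nonneg (by positivity), Real.rpow_neg ht0.le, ← div_eq_mul_inv, Real.rpow_one]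
  exact h t ht0

theorem mellinConvergent_expSum (j : ℕ) {s : ℂ} (h1 : 1 < s.re) (h2 : s.re < 2) :
    MellinConvergent (fun t => (expSum j t : ℂ)) s :=
  mellinConvergent_of_isBigO_rpow (locallyIntegrableOn_ofReal_comp (continuousOn_expSum j))
    (isBigO_expSum_top j) h2 (isBigO_expSum_zero j) h1

theorem mellin_expSum (j : ℕ) {s : ℂ} (h1 : 1 < s.re) :
    mellin (fun t => (expSum j t : ℂ)) s = Complex.Gamma (s + j) * riemannZeta (2 * s - 1) := by
  have hj : (0 : ℝ) ≤ j := by positivity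
  have hpow : ∀ k : ℕ, (((k : ℝ) + 1) ^ (2 * j + 1)) / ((((k : ℝ) + 1) ^ 2) ^ (s.re + j)) =
      1 / ((k + 1 : ℕ) : ℝ) ^ (2 * s.re - 1) := by
    intro k
    have hk : (0 : ℝ) < (k : ℝ) + 1 := by positivity
    push_cast
    rw [← Real.rpow_natCast, ← Real.rpow_natCast, ← Real.rpow_mul hk.le, ← Real.rpow_sub hk,
      one_div, ← Real.rpow_neg hk.le]
    congr 1
    push_cast
    ring
  -- The factor `t^j` is absorbed by shifting the argument to `s + j`; what remains is a
  -- Dirichlet-type series of exponentials, transformed termwise.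
  have h := hasSum_mellin (ι := ℕ) (a := fun k => ((((k : ℝ) + 1) ^ (2 * j + 1) : ℝ) : ℂ))
    (p := fun k => ((k : ℝ) + 1) ^ 2) (s := s + j)
    (F := fun t => ∑' k : ℕ, ((((k : ℝ) + 1) ^ (2 * j + 1) : ℝ) : ℂ) *
      Real.exp (-((k : ℝ) + 1) ^ 2 * t))
    (fun k => Or.inr (by positivity)) (by simp; linarith) (fun t ht => ?_) ?_
  · have e : mellin (fun t => ∑' k : ℕ, ((((k : ℝ) + 1) ^ (2 * j + 1) : ℝ) : ℂ) *
      Real.exp (-((k : ℝ) + 1) ^ 2 * t)) (s + j) = mellin (fun t => (expSum j t : ℂ)) s := by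
      rw [← mellin_cpow_smul, mellin, mellin]
      refine setIntegral_congr_fun measurableSet_Ioi fun t _ => ?_
      congr 1
      rw [expSum, Complex.ofReal_tsum, smul_eq_mul, ← tsum_mul_left, Complex.cpow_natCast]
      refine tsum_congr fun k => ?_
      rw [neg_mul, mul_pow (_ ^ 2), ← pow_mul]
      push_cast
      ring
    rw [e] at h
    rw [← h.tsum_eq]
    simp_rw [mul_div_assoc]
    rw [tsum_mul_left, zeta_eq_tsum_one_div_nat_add_one_cpow (by simp; linarith)]
    congr 1
    refine tsum_congr fun k => ?_
    have hk : ((k : ℂ) + 1) ≠ 0 := by exact_mod_cast (Nat.succ_ne_zero k)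
    have h2 : ((((k : ℝ) + 1) ^ 2 : ℝ) : ℂ) ^ (s + j) = ((k : ℂ) + 1) ^ (2 * (s + j)) := by
      have := Complex.natCast_mul_natCast_cpow (k + 1) (k + 1) (s + j)
      push_cast at this ⊢
      rw [sq, this, ← Complex.cpow_add _ _ hk]
      ring_nf
    rw [h2]
    push_cast
    rw [← Complex.cpow_natCast, ← Complex.cpow_sub _ _ hk, one_div, ← Complex.cpow_neg]
    congr 1
    push_cast
    ring
  · refine Summable.hasSum ?_
    have ht' : (0 : ℝ) < t := ht
    have hs := (summable_expSum j ht').div_const (t ^ j)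
    refine (Complex.ofRealCLM.summable hs).congr fun k => ?_
    have e : ((k : ℝ) + 1) * ((((k : ℝ) + 1) ^ 2 * t) ^ j * Real.exp (-(((k : ℝ) + 1) ^ 2 * t))) /
        t ^ j = ((k : ℝ) + 1) ^ (2 * j + 1) * Real.exp (-((k : ℝ) + 1) ^ 2 * t) := by
      rw [neg_mul, mul_pow, ← pow_mul]; field_simp; ring
    rw [e]
    simp
  · refine Summable.congr (f := fun k : ℕ => 1 / ((k + 1 : ℕ) : ℝ) ^ (2 * s.re - 1)) ?_ fun k => ?_
    · exact (summable_nat_add_iff 1).2 (Real.summable_one_div_nat_rpow.2 (by linarith))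
    · rw [← hpow k, Complex.norm_real, Real.norm_of_nonneg (by positivity)]
      simp

/-- The entire function `(w - 1) ζ(w)`. -/
noncomputable def zetaMul : ℂ → ℂ := Function.update (fun w => (w - 1) * riemannZeta w) 1 1

theorem zetaMul_of_ne {w : ℂ} (h : w ≠ 1) : zetaMul w = (w - 1) * riemannZeta w :=
  Function.update_of_ne h _ _

theorem differentiable_zetaMul : Differentiable ℂ zetaMul := by
  have h0 : ∀ w : ℂ, w ≠ 1 → DifferentiableAt ℂ zetaMul w := by
    intro w hw
    have h : zetaMul =ᶠ[𝓝 w] fun w => (w - 1) * riemannZeta w :=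
      (eventually_ne_nhds hw).mono fun z hz => zetaMul_of_ne hz
    refine DifferentiableAt.congr_of_eventuallyEq ?_ h
    exact (differentiableAt_id.sub_const 1).mul (differentiableAt_riemannZeta hw)
  intro w
  by_cases hw : w = 1
  · subst hw
    refine (Complex.analyticAt_of_differentiable_on_punctured_nhds_of_continuousAt ?_
      ?_).differentiableAt
    · filter_upwards [self_mem_nhdsWithin] with w hw using h0 w hw
    · exact continuousAt_update_same.2 riemannZeta_residue_one
  · exact h0 w hw

theorem mellin_brSumReg_strip {s : ℂ} (h1 : 1 < s.re) (h2 : s.re < 2) :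
    mellin brSumReg s = (4 * s - 2) * Complex.Gamma s * riemannZeta (2 * s - 1) -
      1 / (s - 1) - 1 / 6 * (1 / s) := by
  have hs0 : s ≠ 0 := by rintro rfl; simp at h1; linarith
  have a := mellinConvergent_expSum 1 h1 h2
  have b := mellinConvergent_expSum 0 h1 h2
  have c := hasMellin_cpow_Ioc (-1) (s := s) (by simp; linarith)
  have d := hasMellin_one_Ioc (s := s) (by linarith)
  have d' := hasMellin_const_smul d.1 (1 / 6 : ℂ)
  have cd := hasMellin_add c.1 d'.1
  have a' := hasMellin_const_smul a (4 : ℂ)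
  have b' := hasMellin_const_smul b (2 : ℂ)
  have ab := hasMellin_sub a'.1 b'.1
  have abcd := hasMellin_sub ab.1 cd.1
  have e : (fun t => ((4 : ℂ) • (expSum 1 t : ℂ) - (2 : ℂ) • (expSum 0 t : ℂ)) -
      (indicator (Ioc 0 1) (fun t : ℝ => (t : ℂ) ^ (-1 : ℂ)) t +
    (1 / 6 : ℂ) • indicator (Ioc 0 1) (fun _ => (1 : ℂ)) t)) = brSumReg := by
    funext t
    rw [brSumReg, brSum]
    push_cast
    simp only [smul_eq_mul]
  rw [e] at abcd
  rw [abcd.2, ab.2, cd.2, a'.2, b'.2, c.2, d'.2, d.2, mellin_expSum 1 h1, mellin_expSum 0 h1]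
  simp only [smul_eq_mul, Nat.cast_one, Nat.cast_zero, add_zero]
  rw [Complex.Gamma_add_one s hs0]
  ring

theorem differentiableAt_mellin_brSumReg {s : ℂ} (h1 : -1 < s.re) (h2 : s.re < 2) :
    DifferentiableAt ℂ (mellin brSumReg) s :=
  mellin_differentiableAt_of_isBigO_rpow locallyIntegrableOn_brSumReg isBigO_brSumReg_top h2
    isBigO_brSumReg_zero h1

/-- Identity theorem: both sides are holomorphic on the strip `-1 < Re s < 2` and agree for `1 < Re
s < 2`, where the transforms of the separate pieces converge. The factor `s (s - 1)` clears the
poles. -/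
theorem mul_mellin_brSumReg {s : ℂ} (h1 : -1 < s.re) (h2 : s.re < 2) :
    s * (s - 1) * mellin brSumReg s =
      (4 * s - 2) * Complex.Gamma (s + 1) * (zetaMul (2 * s - 1) / 2) - s - (s - 1) / 6 := by
  set U : Set ℂ := Complex.re ⁻¹' Ioo (-1 : ℝ) 2 with hU
  have hUo : IsOpen U := isOpen_Ioo.preimage Complex.continuous_re
  have hUc : Convex ℝ U := (convex_Ioo (-1 : ℝ) 2).linear_preimage Complex.reLm
  have hL : DifferentiableOn ℂ (fun s => s * (s - 1) * mellin brSumReg s) U := fun s hs =>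
    ((differentiableAt_id.mul (differentiableAt_id.sub_const 1)).mul
      (differentiableAt_mellin_brSumReg hs.1 hs.2)).differentiableWithinAt
  have hR : DifferentiableOn ℂ (fun s => (4 * s - 2) * Complex.Gamma (s + 1) *
      (zetaMul (2 * s - 1) / 2) - s - (s - 1) / 6) U := by
    intro s hs
    have hG : DifferentiableAt ℂ (fun s => Complex.Gamma (s + 1)) s := by
      refine DifferentiableAt.comp (f := fun s : ℂ => s + 1) s
        (Complex.differentiableAt_Gamma _ fun m h => ?_) (by fun_prop)
      have := congrArg Complex.re h
      simp at this
      have hs1 : -1 < s.re := hs.1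
      have : (0 : ℝ) ≤ m := by positivity
      linarith
    have hZ : DifferentiableAt ℂ (fun s => zetaMul (2 * s - 1)) s :=
      DifferentiableAt.comp (f := fun s : ℂ => 2 * s - 1) s (differentiable_zetaMul _) (by fun_prop)
    exact (by fun_prop : DifferentiableAt ℂ (fun s => (4 * s - 2) * Complex.Gamma (s + 1) *
      (zetaMul (2 * s - 1) / 2) - s - (s - 1) / 6) s).differentiableWithinAt
  have hz : (3 / 2 : ℂ) ∈ U := by
    rw [hU]; norm_num
  have heq : (fun s => s * (s - 1) * mellin brSumReg s) =ᶠ[𝓝 (3 / 2 : ℂ)] (fun s => (4 * s - 2) *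
      Complex.Gamma (s + 1) * (zetaMul (2 * s - 1) / 2) - s - (s - 1) / 6) := by
    have hV : Complex.re ⁻¹' Ioo (1 : ℝ) 2 ∈ 𝓝 (3 / 2 : ℂ) :=
      (isOpen_Ioo.preimage Complex.continuous_re).mem_nhds (by norm_num)
    filter_upwards [hV] with s hs
    have hs1 : 1 < s.re := hs.1
    have h0 : s ≠ 0 := by rintro rfl; simp at hs1; linarith
    have h1 : s - 1 ≠ 0 := by
      intro h; rw [sub_eq_zero.1 h] at hs1; simp at hs1
    have h3 : 2 * s - 1 ≠ 1 := by
      intro h; apply h1; linear_combination h / 2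
    rw [mellin_brSumReg_strip hs.1 hs.2, zetaMul_of_ne h3, Complex.Gamma_add_one s h0]
    field_simp
    ring
  exact (hL.analyticOnNhd hUo).eqOn_of_preconnected_of_eventuallyEq (hR.analyticOnNhd hUo)
    hUc.isPreconnected hz heq ⟨h1, h2⟩

theorem mellin_brSumReg {s : ℂ} (h1 : -1 < s.re) (h2 : s.re < 2) (hs0 : s ≠ 0) (hs1 : s ≠ 1) :
    mellin brSumReg s = (4 * s - 2) * Complex.Gamma s * riemannZeta (2 * s - 1) -
      1 / (s - 1) - 1 / (6 * s) := by
  have h := mul_mellin_brSumReg h1 h2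
  have hs1' : s - 1 ≠ 0 := sub_ne_zero.2 hs1
  have h3 : 2 * s - 1 ≠ 1 := by
    intro h; apply hs1'; linear_combination h / 2
  rw [zetaMul_of_ne h3, Complex.Gamma_add_one s hs0] at h
  apply mul_left_cancel₀ (mul_ne_zero hs0 hs1')
  rw [h]
  field_simp
  ring

theorem riemannZeta_neg_one : riemannZeta (-1) = -1 / 12 := by
  have := riemannZeta_neg_nat_eq_bernoulli 1
  norm_num [bernoulli_two] at this
  rw [this]; norm_num

/-- At `s = 0` the identity `mul_mellin_brSumReg` is `0 = 0`, so the value is read off from the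
derivatives of both sides. This is where `ζ'(-1)` and `Γ'(1) = -γ` enter. -/
theorem mellin_brSumReg_zero : mellin brSumReg 0 = 2 / 3 - Real.eulerMascheroniConstant / 6 -
    4 * deriv riemannZeta (-1) := by
  have hL : HasDerivAt (fun s => s * (s - 1) * mellin brSumReg s) (-mellin brSumReg 0) 0 := by
    have hm := (differentiableAt_mellin_brSumReg (s := 0) (by simp) (by simp)).hasDerivAt
    refine (((hasDerivAt_id (0 : ℂ)).mul ((hasDerivAt_id (0 : ℂ)).sub_const 1)).mul
      hm).congr_deriv ?_
    simp
  have hR : HasDerivAt (fun s => (4 * s - 2) * Complex.Gamma (s + 1) *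
      (((2 * s - 1 - 1) * riemannZeta (2 * s - 1)) / 2) - s - (s - 1) / 6)
      (-(2 / 3 - Real.eulerMascheroniConstant / 6 - 4 * deriv riemannZeta (-1))) 0 := by
    have hlin : HasDerivAt (fun s : ℂ => 4 * s - 2) 4 0 := by
      simpa using ((hasDerivAt_id (0 : ℂ)).const_mul 4).sub_const 2
    have hlin2 : HasDerivAt (fun s : ℂ => 2 * s - 1) 2 0 := by
      simpa using ((hasDerivAt_id (0 : ℂ)).const_mul 2).sub_const 1
    have hG : HasDerivAt (fun s : ℂ => Complex.Gamma (s + 1)) (-Real.eulerMascheroniConstant) 0 := by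
      have h1 : HasDerivAt Complex.Gamma (-Real.eulerMascheroniConstant) ((0 : ℂ) + 1) := by
        rw [zero_add]; exact Complex.hasDerivAt_Gamma_one
      exact h1.comp_add_const 0 1
    have hZ : HasDerivAt (fun s : ℂ => riemannZeta (2 * s - 1)) (deriv riemannZeta (-1) * 2) 0 := by
      have h1 : HasDerivAt riemannZeta (deriv riemannZeta (-1)) (2 * (0 : ℂ) - 1) := by
        rw [mul_zero, zero_sub]
        exact (differentiableAt_riemannZeta (by norm_num)).hasDerivAt
      exact h1.comp 0 hlin2
    have := (((hlin.mul hG).mul (((hlin2.sub_const 1).mul hZ).div_const 2)).sub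
      (hasDerivAt_id (0 : ℂ))).sub (((hasDerivAt_id (0 : ℂ)).sub_const 1).div_const 6)
    refine this.congr_deriv ?_
    simp [riemannZeta_neg_one]
    ring
  have heq : (fun s => s * (s - 1) * mellin brSumReg s) =ᶠ[𝓝 (0 : ℂ)]
      (fun s => (4 * s - 2) * Complex.Gamma (s + 1) *
      (((2 * s - 1 - 1) * riemannZeta (2 * s - 1)) / 2) - s - (s - 1) / 6) := by
    have hV : Complex.re ⁻¹' Ioo (-1 : ℝ) 1 ∈ 𝓝 (0 : ℂ) :=
      (isOpen_Ioo.preimage Complex.continuous_re).mem_nhds (by simp)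
    filter_upwards [hV] with s hs
    have hs2 : s.re < 1 := hs.2
    have h3 : 2 * s - 1 ≠ 1 := by
      intro h
      have : s = 1 := by linear_combination h / 2
      rw [this] at hs2
      simp at hs2
    rw [mul_mellin_brSumReg hs.1 (by linarith), zetaMul_of_ne h3]
  have := (hR.congr_of_eventuallyEq heq).unique hL
  linear_combination this

end TreeBranches

namespace TreeBranches

open MeasureTheory Set Filter Topology

/-! ### The periodic fluctuation -/

/-- The `r`-th term of the two-sided sum, with the divergent part removed. -/
noncomputable def brTerm (r : ℤ) (x : ℝ) : ℝ :=
  brSum ((4 : ℝ) ^ ((r : ℝ) - x)) - if r ≤ 0 then (4 : ℝ) ^ (x - r) + 1 / 6 else 0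

theorem summable_quarter_pow_natAbs : Summable fun r : ℤ => (1 / 4 : ℝ) ^ r.natAbs := by
  have h : Summable fun n : ℕ => (1 / 4 : ℝ) ^ n :=
    summable_geometric_of_lt_one (by norm_num) (by norm_num)
  refine summable_int_iff_summable_nat_and_neg.2 ⟨?_, ?_⟩ <;> simpa using h

/-- With `t = 4^(r - x)` the term is `O(t)` for `r ≤ 0` and `O(t⁻²)` for `r > 0`. The bound is
locally uniform in `x`, hence also gives continuity of the sum. -/
theorem exists_abs_brTerm_le : ∃ C : ℝ, 0 ≤ C ∧ ∀ (r : ℤ) (x : ℝ),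
    |brTerm r x| ≤ C * (4 : ℝ) ^ (2 * |x|) * (1 / 4 : ℝ) ^ r.natAbs := by
  obtain ⟨C, hC, h⟩ := exists_abs_brSum_sub_le
  obtain ⟨D, hD, h'⟩ := exists_abs_brSum_le
  refine ⟨C + D, by positivity, fun r x => ?_⟩
  have hpos : (0 : ℝ) < (4 : ℝ) ^ ((r : ℝ) - x) := by positivity
  have habs : (1 / 4 : ℝ) ^ r.natAbs = (4 : ℝ) ^ (-|(r : ℝ)|) := by
    rw [Real.rpow_neg (by norm_num), ← Int.cast_abs, Int.abs_eq_natAbs, Int.cast_natCast,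
      Real.rpow_natCast, one_div, inv_pow]
  rw [habs, mul_assoc, ← Real.rpow_add (by norm_num)]
  rcases le_or_gt r 0 with hr | hr
  · have hr' : (r : ℝ) ≤ 0 := by exact_mod_cast hr
    rw [brTerm, if_pos hr]
    have e : (4 : ℝ) ^ (x - r) = 1 / (4 : ℝ) ^ ((r : ℝ) - x) := by
      rw [one_div, ← Real.rpow_neg (by norm_num), neg_sub]
    rw [e, ← sub_sub]
    refine (h _ hpos).trans ?_
    gcongr
    · linarith
    · norm_num
    · rw [abs_of_nonpos hr']
      linarith [neg_abs_le x, abs_nonneg x]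
  · have hr' : (0 : ℝ) < r := by exact_mod_cast hr
    rw [brTerm, if_neg (by omega), sub_zero]
    refine (h' _ hpos).trans ?_
    rw [div_eq_mul_inv, ← Real.rpow_natCast, ← Real.rpow_mul (by norm_num),
      ← Real.rpow_neg (by norm_num)]
    gcongr
    · linarith
    · norm_num
    · rw [abs_of_pos hr']
      push_cast
      linarith [le_abs_self x]

theorem summable_brTerm (x : ℝ) : Summable fun r : ℤ => brTerm r x := by
  obtain ⟨C, hC, h⟩ := exists_abs_brTerm_le
  exact Summable.of_norm_bounded (summable_quarter_pow_natAbs.mul_left _) fun r => h r x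

theorem continuous_brTerm (r : ℤ) : Continuous (brTerm r) := by
  have h4 : ∀ g : ℝ → ℝ, Continuous g → Continuous fun x => (4 : ℝ) ^ g x := fun g hg =>
    continuous_const.rpow hg fun _ => Or.inl (by norm_num)
  have h1 : Continuous fun x : ℝ => brSum ((4 : ℝ) ^ ((r : ℝ) - x)) :=
    continuousOn_brSum.comp_continuous (h4 _ (by fun_prop)) fun x => by
      simp only [mem_Ioi]; positivity
  unfold brTerm
  refine h1.sub ?_
  split_ifs
  · exact (h4 _ (by fun_prop)).add_const _
  · exact continuous_const

/-- The two-sided sum of all `brTerm r x`. -/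
noncomputable def brTotal (x : ℝ) : ℝ := ∑' r : ℤ, brTerm r x

theorem continuous_brTotal : Continuous brTotal := by
  obtain ⟨C, hC, h⟩ := exists_abs_brTerm_le
  refine continuous_iff_continuousAt.2 fun x₀ => ?_
  have hc : ContinuousOn brTotal (Ioo (-(|x₀| + 1)) (|x₀| + 1)) := by
    refine continuousOn_tsum (u := fun r : ℤ => C * (4 : ℝ) ^ (2 * (|x₀| + 1)) *
      (1 / 4 : ℝ) ^ r.natAbs) (fun r => (continuous_brTerm r).continuousOn)
      (summable_quarter_pow_natAbs.mul_left _) fun r x hx => ?_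
    refine (h r x).trans ?_
    gcongr
    · norm_num
    · exact abs_le.2 ⟨hx.1.le, hx.2.le⟩
  refine hc.continuousAt (Ioo_mem_nhds ?_ ?_)
  · linarith [neg_abs_le x₀]
  · linarith [le_abs_self x₀]

/-- Shifting `r` along with `x` leaves `r - x` unchanged; only the cutoff `r ≤ 0` moves, and this
affects a single index. -/
theorem brTotal_add_one (x : ℝ) : brTotal (x + 1) = brTotal x + ((4 : ℝ) ^ x + 1 / 6) := by
  have h : ∀ r : ℤ, brTerm (r + 1) (x + 1) =
      brTerm r x + if r = 0 then (4 : ℝ) ^ x + 1 / 6 else 0 := by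
    intro r
    rw [brTerm, brTerm]
    push_cast
    rw [show (r : ℝ) + 1 - (x + 1) = r - x by ring, show x + 1 - ((r : ℝ) + 1) = x - r by ring]
    rcases lt_trichotomy r 0 with hr | hr | hr
    · rw [if_pos (by omega), if_pos (by omega), if_neg (by omega)]; ring
    · subst hr; simp
    · rw [if_neg (by omega), if_neg (by omega), if_neg (by omega)]; ring
  rw [brTotal, ← (Equiv.addRight (1 : ℤ)).tsum_eq]
  simp only [Equiv.coe_addRight, h]
  rw [(summable_brTerm x).tsum_add (summable_of_ne_finset_zero (s := {0})
    fun b hb => if_neg (by simpa using hb)), tsum_ite_eq,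
    brTotal]

/-- The periodic part of the two-sided sum. -/
noncomputable def brPer (x : ℝ) : ℝ := brTotal x - (4 : ℝ) ^ x / 3 - x / 6

theorem periodic_brPer : Function.Periodic brPer 1 := by
  intro x
  rw [brPer, brPer, brTotal_add_one, Real.rpow_add_one (by norm_num)]
  ring

theorem continuous_brPer : Continuous brPer :=
  (continuous_brTotal.sub ((continuous_const.rpow continuous_id fun _ =>
    Or.inl (by norm_num)).div_const 3)).sub (continuous_id.div_const 6)

theorem four_rpow_eq (x : ℝ) : (4 : ℝ) ^ x = Real.exp (Real.log 4 * x) :=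
  Real.rpow_def_of_pos (by norm_num) x

theorem log_four : Real.log 4 = 2 * Real.log 2 := by
  rw [show (4 : ℝ) = 2 ^ 2 by norm_num, Real.log_pow]; norm_num

theorem log_four_pos : 0 < Real.log 4 := Real.log_pos (by norm_num)

theorem chi_mul_log (k : ℤ) : chi k / 2 * Real.log 4 = 2 * Real.pi * Complex.I * k := by
  have h : (Real.log 2 : ℂ) ≠ 0 := Complex.ofReal_ne_zero.2 (Real.log_pos (by norm_num)).ne'
  rw [chi, log_four]
  push_cast
  field_simp

theorem chi_re (k : ℤ) : (chi k / 2).re = 0 := by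
  have : chi k / 2 = ((Real.pi * k / Real.log 2 : ℝ) : ℂ) * Complex.I := by
    rw [chi]; push_cast; ring
  rw [this, Complex.re_ofReal_mul, Complex.I_re, mul_zero]

theorem image_four_rpow_neg : (fun y : ℝ => Real.exp (-(Real.log 4 * y))) '' univ = Ioi 0 := by
  ext t
  simp only [image_univ, mem_range, mem_Ioi]
  constructor
  · rintro ⟨y, rfl⟩; positivity
  · intro ht
    refine ⟨-(Real.log t / Real.log 4), ?_⟩
    rw [mul_neg, neg_neg, mul_div_cancel₀ _ log_four_pos.ne', Real.exp_log ht]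

/-- The substitution `t = 4^(-y)` turns the Mellin integral on the imaginary axis into a Fourier
integral over the line. -/
theorem mellin_brSumReg_chi (k : ℤ) :
    Integrable (fun y : ℝ => Complex.exp (-(2 * Real.pi * Complex.I * k * y)) *
      brSumReg ((4 : ℝ) ^ (-y))) ∧
    ∫ y : ℝ, Complex.exp (-(2 * Real.pi * Complex.I * k * y)) * brSumReg ((4 : ℝ) ^ (-y)) =
      mellin brSumReg (chi k / 2) / Real.log 4 := by
  have hL : (Real.log 4 : ℂ) ≠ 0 := Complex.ofReal_ne_zero.2 log_four_pos.ne'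
  have hd : ∀ y ∈ (univ : Set ℝ), HasDerivWithinAt (fun y : ℝ => Real.exp (-(Real.log 4 * y)))
      (-Real.log 4 * Real.exp (-(Real.log 4 * y))) univ y := by
    intro y _
    have := ((hasDerivAt_id y).const_mul (Real.log 4)).neg.exp
    refine (this.congr_deriv ?_).hasDerivWithinAt
    simp
    ring
  have hinj : InjOn (fun y : ℝ => Real.exp (-(Real.log 4 * y))) univ := by
    intro a _ b _ hab
    have := Real.exp_injective hab
    exact mul_left_cancel₀ log_four_pos.ne' (neg_injective this)
  have hpt : ∀ y : ℝ, |-Real.log 4 * Real.exp (-(Real.log 4 * y))| •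
      (((Real.exp (-(Real.log 4 * y)) : ℝ) : ℂ) ^ (chi k / 2 - 1) •
        brSumReg (Real.exp (-(Real.log 4 * y)))) =
      (Real.log 4 : ℂ) * (Complex.exp (-(2 * Real.pi * Complex.I * k * y)) *
        brSumReg ((4 : ℝ) ^ (-y))) := by
    intro y
    have he := Real.exp_pos (-(Real.log 4 * y))
    have e1 : ((Real.exp (-(Real.log 4 * y)) : ℝ) : ℂ) ^ (chi k / 2 - 1) =
        Complex.exp (-(2 * Real.pi * Complex.I * k * y)) / (Real.exp (-(Real.log 4 * y)) : ℝ) := by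
      rw [Complex.cpow_sub _ _ (Complex.ofReal_ne_zero.2 he.ne'), Complex.cpow_one]
      congr 1
      rw [Complex.cpow_def_of_ne_zero (Complex.ofReal_ne_zero.2 he.ne'), ← Complex.ofReal_log he.le,
        Real.log_exp]
      congr 1
      push_cast
      linear_combination -(y : ℂ) * chi_mul_log k
    rw [e1, four_rpow_eq, mul_neg, neg_mul, abs_neg, abs_of_pos (mul_pos log_four_pos he),
      Complex.real_smul, smul_eq_mul]
    have hne : ((Real.exp (-(Real.log 4 * y)) : ℝ) : ℂ) ≠ 0 := Complex.ofReal_ne_zero.2 he.ne'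
    rw [Complex.ofReal_mul]
    field_simp
  have hconv : MellinConvergent brSumReg (chi k / 2) :=
    mellinConvergent_of_isBigO_rpow locallyIntegrableOn_brSumReg isBigO_brSumReg_top
      (by rw [chi_re]; norm_num) isBigO_brSumReg_zero (by rw [chi_re]; norm_num)
  constructor
  · rw [MellinConvergent, ← image_four_rpow_neg,
      integrableOn_image_iff_integrableOn_abs_deriv_smul MeasurableSet.univ hd hinj] at hconv
    simp_rw [hpt] at hconv
    rw [integrableOn_univ] at hconv
    have := hconv.const_mul (Real.log 4 : ℂ)⁻¹
    refine this.congr (Eventually.of_forall fun y => ?_)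
    simp only
    rw [inv_mul_cancel_left₀ hL]
  · rw [mellin, ← image_four_rpow_neg, integral_image_eq_integral_abs_deriv_smul
      MeasurableSet.univ hd hinj]
    simp_rw [hpt]
    rw [setIntegral_univ, integral_const_mul, mul_div_cancel_left₀ _ hL]

/-- For `0 < x < 1`, the cutoff `t ≤ 1` at `t = 4^(r - x)` is the cutoff `r ≤ 0`. -/
theorem brSumReg_eq_brTerm (r : ℤ) {x : ℝ} (h0 : 0 < x) (h1 : x < 1) :
    brSumReg ((4 : ℝ) ^ ((r : ℝ) - x)) = (brTerm r x : ℂ) := by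
  rcases le_or_gt r 0 with hr | hr
  · have hr' : (r : ℝ) ≤ 0 := by exact_mod_cast hr
    rw [brSumReg_of_le (by positivity)
      (Real.rpow_le_one_of_one_le_of_nonpos (by norm_num) (by linarith)), brTerm, if_pos hr,
      show x - (r : ℝ) = -((r : ℝ) - x) by ring, Real.rpow_neg (by norm_num)]
    congr 1
    ring
  · have hr' : (1 : ℝ) ≤ r := by exact_mod_cast hr
    rw [brSumReg_of_lt (Real.one_lt_rpow (by norm_num) (by linarith)), brTerm, if_neg (by omega),
      sub_zero]

/-- Unfolding: the integral over one period of a sum over integer translates is the integral over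
the line. -/
theorem integral_exp_mul_brTotal (k : ℤ) :
    ∫ x in (0 : ℝ)..1, Complex.exp (-(2 * Real.pi * Complex.I * k * x)) * (brTotal x : ℂ) =
      mellin brSumReg (chi k / 2) / Real.log 4 := by
  obtain ⟨hi, he⟩ := mellin_brSumReg_chi k
  obtain ⟨C, hC, hb⟩ := exists_abs_brTerm_le
  have hnorm : ∀ x : ℝ, ‖Complex.exp (-(2 * Real.pi * Complex.I * k * x))‖ = 1 := by
    intro x
    rw [show -(2 * Real.pi * Complex.I * k * x : ℂ) = ((-(2 * Real.pi * k * x) : ℝ) : ℂ) *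
      Complex.I by push_cast; ring, Complex.norm_exp_ofReal_mul_I]
  have h1 : HasSum (fun r : ℤ => ∫ x in (0 : ℝ)..1,
      Complex.exp (-(2 * Real.pi * Complex.I * k * x)) * (brTerm r x : ℂ))
      (∫ x in (0 : ℝ)..1, Complex.exp (-(2 * Real.pi * Complex.I * k * x)) * (brTotal x : ℂ)) := by
    refine intervalIntegral.hasSum_integral_of_dominated_convergence
      (fun r _ => C * (4 : ℝ) ^ (2 * (1 : ℝ)) * (1 / 4 : ℝ) ^ r.natAbs) (fun r => ?_) (fun r => ?_)
      ?_ ?_ ?_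
    · have := continuous_brTerm r
      exact (by fun_prop : Continuous fun x : ℝ =>
        Complex.exp (-(2 * Real.pi * Complex.I * k * x)) * (brTerm r x : ℂ)).aestronglyMeasurable
    · refine Eventually.of_forall fun x hx => ?_
      rw [uIoc_of_le zero_le_one] at hx
      rw [norm_mul, hnorm, one_mul, Complex.norm_real]
      refine (hb r x).trans ?_
      gcongr
      · norm_num
      · exact abs_le.2 ⟨by linarith [hx.1], hx.2⟩
    · exact Eventually.of_forall fun x _ => summable_quarter_pow_natAbs.mul_left _
    · exact intervalIntegrable_const
    · refine Eventually.of_forall fun x _ => ?_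
      exact (Complex.hasSum_ofReal.2 (summable_brTerm x).hasSum).mul_left _
  have h2 := hi.hasSum_intervalIntegral_comp_add_int
  rw [← (Equiv.neg ℤ).hasSum_iff] at h2
  rw [← he]
  refine h1.unique (h2.congr_fun ?_)
  intro r
  simp only [Function.comp_apply, Equiv.neg_apply]
  refine intervalIntegral.integral_congr_ae ?_
  -- At `x = 1` the two cutoffs disagree for the index `r = 1`.
  have : ∀ᵐ x : ℝ, x ≠ 1 := by simp [ae_iff, measure_singleton]
  filter_upwards [this] with x hx1 hx
  rw [uIoc_of_le zero_le_one] at hx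
  rw [← brSumReg_eq_brTerm r hx.1 (lt_of_le_of_ne hx.2 hx1)]
  push_cast
  congr 1
  · rw [Complex.exp_eq_exp_iff_exists_int]
    refine ⟨-(k * r), ?_⟩
    push_cast
    ring
  · congr 2
    ring

theorem integral_exp_mul_four_rpow (k : ℤ) :
    ∫ x in (0 : ℝ)..1, Complex.exp (-(2 * Real.pi * Complex.I * k * x)) * (((4 : ℝ) ^ x : ℝ) : ℂ) =
      3 / (Real.log 4 * (1 - chi k / 2)) := by
  have hL : (Real.log 4 : ℂ) ≠ 0 := Complex.ofReal_ne_zero.2 log_four_pos.ne'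
  have hs : (1 - chi k / 2) ≠ 0 := by
    intro h
    have := congrArg Complex.re h
    rw [Complex.sub_re, chi_re] at this
    simp at this
  have e : ∀ x : ℝ, Complex.exp (-(2 * Real.pi * Complex.I * k * x)) * (((4 : ℝ) ^ x : ℝ) : ℂ) =
      Complex.exp (Real.log 4 * (1 - chi k / 2) * x) := by
    intro x
    rw [four_rpow_eq, Complex.ofReal_exp, ← Complex.exp_add]
    congr 1
    push_cast
    linear_combination (x : ℂ) * chi_mul_log k
  simp_rw [e]
  rw [integral_exp_mul_complex (mul_ne_zero hL hs)]
  congr 1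
  have e1 : Complex.exp (Real.log 4 * (1 - chi k / 2) * (1 : ℝ)) = 4 := by
    rw [← e 1]
    have : Complex.exp (-(2 * Real.pi * Complex.I * k * ((1 : ℝ) : ℂ))) = 1 := by
      rw [Complex.exp_eq_one_iff]
      exact ⟨-k, by push_cast; ring⟩
    rw [this]
    norm_num
  rw [e1]
  norm_num

theorem integral_exp_mul_self {k : ℤ} (hk : k ≠ 0) :
    ∫ x in (0 : ℝ)..1, Complex.exp (-(2 * Real.pi * Complex.I * k * x)) * (x : ℂ) =
      -1 / (2 * Real.pi * Complex.I * k) := by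
  set a : ℂ := 2 * Real.pi * Complex.I * k with ha
  have ha0 : a ≠ 0 := by
    rw [ha]
    exact mul_ne_zero Complex.two_pi_I_ne_zero (by exact_mod_cast hk)
  have hd : ∀ x ∈ uIcc (0 : ℝ) 1, HasDerivAt
      (fun x : ℝ => -((x : ℂ) / a + 1 / a ^ 2) * Complex.exp (-(a * x)))
      (Complex.exp (-(a * x)) * (x : ℂ)) x := by
    intro x _
    have h1 : HasDerivAt (fun x : ℝ => (x : ℂ)) 1 x := Complex.ofRealCLM.hasDerivAt
    have h2 := (((h1.div_const a).add_const (1 / a ^ 2)).neg).mul ((h1.const_mul a).neg.cexp)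
    refine h2.congr_deriv ?_
    simp only [Pi.neg_apply]
    field_simp
    ring
  rw [intervalIntegral.integral_eq_sub_of_hasDerivAt hd
    ((by fun_prop : Continuous fun x : ℝ => Complex.exp (-(a * x)) * (x : ℂ)).intervalIntegrable
      _ _)]
  have : Complex.exp (-(a * ((1 : ℝ) : ℂ))) = 1 := by
    rw [Complex.exp_eq_one_iff]
    exact ⟨-k, by rw [ha]; push_cast; ring⟩
  rw [this]
  simp
  field_simp

end TreeBranches

namespace TreeBranches

open MeasureTheory Set Filter Topology

/-! ### Decay of the Fourier coefficients -/

/-- Reflection formula, with `Γ(1 - iy) = -iy` times the conjugate of `Γ(iy)`. -/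
theorem norm_Gamma_mul_I_sq {y : ℝ} (hy : y ≠ 0) :
    ‖Complex.Gamma (y * Complex.I)‖ ^ 2 * (|y| * |Real.sinh (Real.pi * y)|) = Real.pi := by
  have h := Complex.Gamma_mul_Gamma_one_sub (y * Complex.I)
  have hz : -((y : ℂ) * Complex.I) ≠ 0 := by
    simp [hy, Complex.I_ne_zero]
  have h1 : Complex.Gamma (1 - y * Complex.I) = -(y * Complex.I) *
      (starRingEnd ℂ) (Complex.Gamma (y * Complex.I)) := by
    rw [← Complex.Gamma_conj, map_mul, Complex.conj_I, Complex.conj_ofReal, sub_eq_neg_add,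
      Complex.Gamma_add_one _ hz, mul_neg]
  have h2 : Complex.sin (Real.pi * (y * Complex.I)) = (Real.sinh (Real.pi * y) : ℝ) * Complex.I := by
    rw [← mul_assoc, Complex.sin_mul_I, Complex.ofReal_sinh, Complex.ofReal_mul]
  have hs : Real.sinh (Real.pi * y) ≠ 0 := by
    rw [Ne, Real.sinh_eq_zero]; exact mul_ne_zero Real.pi_ne_zero hy
  have h3 := congrArg norm h
  rw [h1, h2, norm_mul, norm_mul, norm_div, norm_mul, norm_neg, norm_mul, Complex.norm_I,
    Complex.norm_conj, Complex.norm_real, Complex.norm_real, Complex.norm_real, Real.norm_eq_abs,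
    Real.norm_eq_abs, Real.norm_eq_abs, abs_of_pos Real.pi_pos,
    eq_div_iff (by simpa using hs)] at h3
  linarith

theorem norm_Gamma_mul_I_le {y : ℝ} (hy : 1 ≤ |y|) :
    ‖Complex.Gamma (y * Complex.I)‖ ≤ 4 * Real.exp (-(Real.pi * |y| / 2)) := by
  have hy0 : y ≠ 0 := by rintro rfl; norm_num at hy
  have h := norm_Gamma_mul_I_sq hy0
  have hpi := Real.pi_gt_three
  have hs : Real.exp (Real.pi * |y|) / 4 ≤ |Real.sinh (Real.pi * y)| := by
    rw [Real.abs_sinh, abs_mul, abs_of_pos Real.pi_pos, Real.sinh_eq]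
    have h1 : Real.exp (-(Real.pi * |y|)) ≤ 1 := Real.exp_le_one_iff.2 (by nlinarith)
    have h2 : Real.pi * |y| + 1 ≤ Real.exp (Real.pi * |y|) := Real.add_one_le_exp _
    nlinarith
  have he := Real.exp_pos (Real.pi * |y|)
  refine le_of_sq_le_sq ?_ (by positivity)
  rw [mul_pow, ← Real.exp_nat_mul]
  have e : ((2 : ℕ) : ℝ) * -(Real.pi * |y| / 2) = -(Real.pi * |y|) := by push_cast; ring
  rw [e, Real.exp_neg, ← div_eq_mul_inv, le_div_iff₀ he]
  have h4 : ‖Complex.Gamma (y * Complex.I)‖ ^ 2 * (1 * (Real.exp (Real.pi * |y|) / 4)) ≤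
      ‖Complex.Gamma (y * Complex.I)‖ ^ 2 * (|y| * |Real.sinh (Real.pi * y)|) := by gcongr
  rw [h] at h4
  nlinarith [Real.pi_lt_four]

theorem norm_cos_le (z : ℂ) : ‖Complex.cos z‖ ≤ Real.exp |z.im| := by
  rw [Complex.cos]
  have h1 : ‖Complex.exp (z * Complex.I)‖ ≤ Real.exp |z.im| := by
    rw [Complex.norm_exp]
    exact Real.exp_le_exp.2 (by simpa using neg_le_abs z.im)
  have h2 : ‖Complex.exp (-z * Complex.I)‖ ≤ Real.exp |z.im| := by
    rw [Complex.norm_exp]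
    exact Real.exp_le_exp.2 (by simpa using le_abs_self z.im)
  rw [norm_div, Complex.norm_two, div_le_iff₀ two_pos]
  linarith [norm_add_le (Complex.exp (z * Complex.I)) (Complex.exp (-z * Complex.I))]

theorem norm_riemannZeta_two_sub_le (y : ℝ) :
    ‖riemannZeta (2 - y * Complex.I)‖ ≤ ∑' n : ℕ, 1 / ((n : ℝ) + 1) ^ 2 := by
  have hs : Summable fun n : ℕ => 1 / ((n : ℝ) + 1) ^ 2 := by
    have := (summable_nat_add_iff 1).2 (Real.summable_one_div_nat_pow.2 (one_lt_two))
    exact_mod_cast this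
  rw [zeta_eq_tsum_one_div_nat_add_one_cpow (by simp)]
  refine tsum_of_norm_bounded hs.hasSum fun n => ?_
  rw [norm_div, norm_one, ← Nat.cast_succ, Complex.norm_natCast_cpow_of_pos (Nat.succ_pos n)]
  simp

/-- In the functional equation the decay of `Γ(2 - iy)` cancels the growth of the cosine, so only a
polynomial factor is left. -/
theorem norm_riemannZeta_sub_one_le {y : ℝ} (hy : 1 ≤ |y|) :
    ‖riemannZeta (y * Complex.I - 1)‖ ≤ (∑' n : ℕ, 1 / ((n : ℝ) + 1) ^ 2) * (16 * |y| ^ 2) := by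
  have hy0 : y ≠ 0 := by rintro rfl; norm_num at hy
  set Z := ∑' n : ℕ, 1 / ((n : ℝ) + 1) ^ 2 with hZ
  have hZ0 : 0 ≤ Z := tsum_nonneg fun n => by positivity
  have him : ∀ a : ℝ, ((a : ℂ) - y * Complex.I).im = -y := by intro a; simp
  have h := riemannZeta_one_sub (s := 2 - y * Complex.I)
    (fun n hn => hy0 (by
      have := congrArg Complex.im hn
      simpa using this))
    (fun hn => hy0 (by
      have := congrArg Complex.im hn
      simpa using this))
  rw [show (1 : ℂ) - (2 - y * Complex.I) = y * Complex.I - 1 by ring] at h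
  have hG : ‖Complex.Gamma (2 - y * Complex.I)‖ ≤
      2 * |y| ^ 2 * (4 * Real.exp (-(Real.pi * |y| / 2))) := by
    have h0 : ((-y : ℝ) : ℂ) * Complex.I ≠ 0 := by simp [hy0, Complex.I_ne_zero]
    have h1 : ((-y : ℝ) : ℂ) * Complex.I + 1 ≠ 0 := by
      intro hh
      have := congrArg Complex.im hh
      exact hy0 (by simpa using this)
    have e : (2 : ℂ) - y * Complex.I = ((-y : ℝ) : ℂ) * Complex.I + 1 + 1 := by push_cast; ring
    rw [e, Complex.Gamma_add_one _ h1, Complex.Gamma_add_one _ h0, norm_mul, norm_mul]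
    have n1 : ‖((-y : ℝ) : ℂ) * Complex.I‖ = |y| := by
      rw [norm_mul, Complex.norm_I, Complex.norm_real, mul_one, Real.norm_eq_abs, abs_neg]
    have n2 : ‖((-y : ℝ) : ℂ) * Complex.I + 1‖ ≤ 2 * |y| := by
      refine (norm_add_le _ _).trans ?_
      rw [n1, norm_one]
      linarith
    have n3 := norm_Gamma_mul_I_le (y := -y) (by rwa [abs_neg])
    rw [abs_neg] at n3
    rw [n1]
    calc _ ≤ 2 * |y| * (|y| * (4 * Real.exp (-(Real.pi * |y| / 2)))) := by gcongr
      _ = _ := by ring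
  have hC : ‖Complex.cos (Real.pi * (2 - y * Complex.I) / 2)‖ ≤ Real.exp (Real.pi * |y| / 2) := by
    refine (norm_cos_le _).trans (Real.exp_le_exp.2 (le_of_eq ?_))
    have : (Real.pi * (2 - y * Complex.I) / 2 : ℂ).im = -(Real.pi * y / 2) := by
      rw [show (Real.pi * (2 - y * Complex.I) / 2 : ℂ) =
        (Real.pi : ℝ) + ((-(Real.pi * y / 2) : ℝ) : ℂ) * Complex.I by push_cast; ring]
      rw [Complex.add_im, Complex.im_ofReal_mul, Complex.ofReal_im, Complex.I_im]; ring
    rw [this, abs_neg, abs_div, abs_mul, abs_of_pos Real.pi_pos, abs_two]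
  have hP : ‖(2 * Real.pi : ℂ) ^ (-(2 - y * Complex.I))‖ ≤ 1 := by
    have : (2 * Real.pi : ℂ) = ((2 * Real.pi : ℝ) : ℂ) := by push_cast; ring
    rw [this, Complex.norm_cpow_eq_rpow_re_of_pos (by positivity)]
    refine Real.rpow_le_one_of_one_le_of_nonpos ?_ (by simp)
    linarith [Real.pi_gt_three]
  rw [h, norm_mul, norm_mul, norm_mul, norm_mul, Complex.norm_two]
  calc _ ≤ 2 * 1 * (2 * |y| ^ 2 * (4 * Real.exp (-(Real.pi * |y| / 2)))) *
      Real.exp (Real.pi * |y| / 2) * Z := by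
        gcongr
        exact norm_riemannZeta_two_sub_le y
    _ = Z * (16 * |y| ^ 2) *
      (Real.exp (-(Real.pi * |y| / 2)) * Real.exp (Real.pi * |y| / 2)) := by ring
    _ = _ := by rw [← Real.exp_add, neg_add_cancel, Real.exp_zero, mul_one]

/-- The coefficients decay exponentially because of the Gamma factor. Cubic decay is recorded
because it still gives a summable series after one factor `k` from differentiation. -/
theorem exists_norm_deltaCoeff_le : ∃ C : ℝ, 0 ≤ C ∧ ∀ k : ℤ, k ≠ 0 →
    ‖deltaCoeff k‖ ≤ C * |1 / (k : ℝ) ^ 3| := by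
  set Z := ∑' n : ℕ, 1 / ((n : ℝ) + 1) ^ 2 with hZ
  have hZ0 : 0 ≤ Z := tsum_nonneg fun n => by positivity
  have hl : 0 < Real.log 2 := Real.log_pos (by norm_num)
  have hl1 : Real.log 2 < 1 := by linarith [Real.log_two_lt_d9]
  have hpi := Real.pi_gt_three
  -- The factors come from the Gamma bound (`4`), the zeta bound (`16 Z |y|²`), `|χ_k - 1| ≤ 2 |y|`,
  -- and `|y|⁶ e^{-|y|/4} ≤ 4⁶ · 6!`.
  refine ⟨1 / Real.log 2 * (4 * Z * 16 * 2 * 4 ^ 6 * 720), by positivity, fun k hk => ?_⟩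
  obtain ⟨y, hy⟩ : ∃ y : ℝ, y = 2 * Real.pi * k / Real.log 2 := ⟨_, rfl⟩
  have hchi : chi k = y * Complex.I := by rw [chi, hy]; push_cast; ring
  have hk1 : (1 : ℝ) ≤ |(k : ℝ)| := by
    rw [← Int.cast_abs]; exact_mod_cast Int.one_le_abs hk
  have hyk : |(k : ℝ)| * 2 ≤ |y| := by
    rw [hy, abs_div, abs_mul, abs_of_pos hl,
      abs_of_pos (by positivity : 0 < 2 * Real.pi), le_div_iff₀ hl]
    nlinarith [abs_nonneg (k : ℝ)]
  have hy2 : 2 ≤ |y| := by linarith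
  have h1 := norm_Gamma_mul_I_le (y := y / 2) (by rw [abs_div, abs_two]; linarith)
  have h2 := norm_riemannZeta_sub_one_le (y := y) (by linarith)
  have h3 : ‖(y : ℂ) * Complex.I - 1‖ ≤ 2 * |y| := by
    refine (norm_sub_le _ _).trans ?_
    rw [norm_mul, Complex.norm_I, Complex.norm_real, norm_one, Real.norm_eq_abs]
    linarith
  have e : (y : ℂ) * Complex.I / 2 = ((y / 2 : ℝ) : ℂ) * Complex.I := by push_cast; ring
  have h4 : |y| ^ 6 * Real.exp (-(Real.pi * |y / 2| / 2)) ≤ 4 ^ 6 * 720 := by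
    have h5 := pow_mul_exp_neg_le (u := |y| / 4) (by positivity) 6
    have h6 : Real.exp (-(Real.pi * |y / 2| / 2)) ≤ Real.exp (-(|y| / 4)) := by
      refine Real.exp_le_exp.2 (neg_le_neg ?_)
      rw [abs_div, abs_two]
      nlinarith [abs_nonneg y]
    calc |y| ^ 6 * Real.exp (-(Real.pi * |y / 2| / 2)) ≤ |y| ^ 6 * Real.exp (-(|y| / 4)) := by
          gcongr
      _ = 4 ^ 6 * ((|y| / 4) ^ 6 * Real.exp (-(|y| / 4))) := by ring
      _ ≤ _ := by
          gcongr
          refine h5.trans ?_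
          norm_num [Nat.factorial]
  have hk3 : |(k : ℝ)| ^ 3 ≤ |y| ^ 3 :=
    pow_le_pow_left₀ (abs_nonneg _) (by linarith) 3
  rw [deltaCoeff, hchi, e, norm_mul, norm_mul, norm_mul, norm_div, norm_one, Complex.norm_real,
    Real.norm_of_nonneg hl.le, mul_assoc (1 / Real.log 2)]
  refine mul_le_mul_of_nonneg_left ?_ (by positivity)
  rw [abs_div, abs_one, abs_pow, mul_one_div, le_div_iff₀ (by positivity)]
  calc _ ≤ 4 * Real.exp (-(Real.pi * |y / 2| / 2)) * (Z * (16 * |y| ^ 2)) * (2 * |y|) *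
        |y| ^ 3 := by gcongr
    _ = 4 * Z * 16 * 2 * (|y| ^ 6 * Real.exp (-(Real.pi * |y / 2| / 2))) := by ring
    _ ≤ 4 * Z * 16 * 2 * (4 ^ 6 * 720) := by gcongr
    _ = _ := by ring

theorem summable_abs_one_div_int_pow {p : ℕ} (hp : 1 < p) :
    Summable fun k : ℤ => |1 / (k : ℝ) ^ p| :=
  (Real.summable_one_div_int_pow.2 hp).abs

theorem summable_norm_deltaCoeff :
    Summable (fun k : {k : ℤ // k ≠ 0} => ‖deltaCoeff k‖) := by
  obtain ⟨C, hC, h⟩ := exists_norm_deltaCoeff_le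
  refine Summable.of_nonneg_of_le (fun _ => norm_nonneg _) (fun k => h k k.2) ?_
  exact ((summable_abs_one_div_int_pow (by norm_num)).mul_left C).subtype _

/-! ### The Fourier series of the periodic part -/

/-- The periodic part as a function on the circle. -/
noncomputable def brCircle : C(UnitAddCircle, ℂ) where
  toFun := (periodic_brPer.comp ((↑) : ℝ → ℂ)).lift
  continuous_toFun := continuous_coinduced_dom.mpr
    (Complex.continuous_ofReal.comp continuous_brPer)

theorem brCircle_coe (x : ℝ) : brCircle (x : UnitAddCircle) = (brPer x : ℂ) := rfl

theorem fourierCoeff_brCircle (k : ℤ) : fourierCoeff brCircle k =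
    mellin brSumReg (chi k / 2) / Real.log 4 - 1 / (Real.log 4 * (1 - chi k / 2)) -
      (∫ x in (0 : ℝ)..1, Complex.exp (-(2 * Real.pi * Complex.I * k * x)) * (x : ℂ)) / 6 := by
  rw [fourierCoeff_eq_intervalIntegral _ _ 0]
  have e : ∀ x : ℝ, (fourier (-k) (x : UnitAddCircle) : ℂ) • brCircle (x : UnitAddCircle) =
      Complex.exp (-(2 * Real.pi * Complex.I * k * x)) * (brTotal x : ℂ) -
      Complex.exp (-(2 * Real.pi * Complex.I * k * x)) * (((4 : ℝ) ^ x : ℝ) : ℂ) / 3 -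
      Complex.exp (-(2 * Real.pi * Complex.I * k * x)) * (x : ℂ) / 6 := by
    intro x
    rw [fourier_coe_apply, brCircle_coe, brPer, smul_eq_mul]
    have : (2 * Real.pi * Complex.I * ((-k : ℤ) : ℂ) * x / ((1 : ℝ) : ℂ)) =
        -(2 * Real.pi * Complex.I * k * x) := by push_cast; ring
    rw [this]
    push_cast
    ring
  simp_rw [e]
  have c1 : Continuous fun x : ℝ =>
      Complex.exp (-(2 * Real.pi * Complex.I * k * x)) * (brTotal x : ℂ) := by
    have := continuous_brTotal
    fun_prop
  have c2 : Continuous fun x : ℝ =>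
      Complex.exp (-(2 * Real.pi * Complex.I * k * x)) * (((4 : ℝ) ^ x : ℝ) : ℂ) / 3 := by
    have : Continuous fun x : ℝ => (4 : ℝ) ^ x :=
      continuous_const.rpow continuous_id fun _ => Or.inl (by norm_num)
    fun_prop
  have c3 : Continuous fun x : ℝ =>
      Complex.exp (-(2 * Real.pi * Complex.I * k * x)) * (x : ℂ) / 6 := by fun_prop
  have c12 := c1.sub c2
  simp only [Pi.sub_def] at c12
  rw [zero_add, intervalIntegral.integral_sub (c12.intervalIntegrable _ _)
    (c3.intervalIntegrable _ _), intervalIntegral.integral_sub (c1.intervalIntegrable _ _)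
    (c2.intervalIntegrable _ _), intervalIntegral.integral_div, intervalIntegral.integral_div,
    integral_exp_mul_brTotal, integral_exp_mul_four_rpow]
  simp only [div_one, one_smul]
  congr 2
  rw [div_right_comm]
  norm_num

theorem chi_ne_zero {k : ℤ} (hk : k ≠ 0) : chi k / 2 ≠ 0 := by
  intro h
  have := chi_mul_log k
  rw [h, zero_mul] at this
  exact mul_ne_zero Complex.two_pi_I_ne_zero (by exact_mod_cast hk) this.symm

theorem chi_ne_one (k : ℤ) : chi k / 2 ≠ 1 := by
  intro h
  have := chi_re k
  rw [h] at this
  simp at this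

/-- The coefficients of `4^x / 3` and `x / 6` cancel exactly the rational terms `1/(s - 1)` and
`1/(6s)` of the Mellin transform at `s = chi k / 2`. -/
theorem fourierCoeff_brCircle_of_ne {k : ℤ} (hk : k ≠ 0) :
    fourierCoeff brCircle k = deltaCoeff k := by
  have hL : (Real.log 2 : ℂ) ≠ 0 := Complex.ofReal_ne_zero.2 (Real.log_pos (by norm_num)).ne'
  have h0 := chi_ne_zero hk
  have h1 := chi_ne_one k
  rw [fourierCoeff_brCircle, integral_exp_mul_self hk, mellin_brSumReg (by rw [chi_re]; norm_num)
    (by rw [chi_re]; norm_num) h0 h1, ← chi_mul_log, deltaCoeff, log_four]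
  have h2 : 2 * (chi k / 2) - 1 = chi k - 1 := by ring
  have h3 : chi k / 2 - 1 ≠ 0 := sub_ne_zero.2 h1
  have h4 : 1 - chi k / 2 = -(chi k / 2 - 1) := by ring
  rw [h2, h4]
  push_cast
  generalize Complex.Gamma (chi k / 2) = G
  generalize riemannZeta (chi k - 1) = Z
  have h5 : chi k = 2 * (chi k / 2) := by ring
  generalize chi k / 2 = s at *
  rw [h5]
  field_simp
  ring

/-- The mean of the periodic part. -/
noncomputable def brMean : ℂ := (2 / 3 - Real.eulerMascheroniConstant / 6 -
    4 * deriv riemannZeta (-1) - 1) / Real.log 4 - 1 / 12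

theorem fourierCoeff_brCircle_zero : fourierCoeff brCircle 0 = brMean := by
  have hc : chi 0 = 0 := by simp [chi]
  have hi : ∫ x in (0 : ℝ)..1, Complex.exp (-(2 * Real.pi * Complex.I * (0 : ℤ) * x)) * (x : ℂ) =
      1 / 2 := by
    have e : ∀ x : ℝ, Complex.exp (-(2 * Real.pi * Complex.I * (0 : ℤ) * x)) * (x : ℂ) =
        ((x : ℝ) : ℂ) := by intro x; simp
    simp_rw [e]
    rw [intervalIntegral.integral_ofReal, integral_id]
    norm_num
  rw [fourierCoeff_brCircle, hi, hc, zero_div, mellin_brSumReg_zero, brMean]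
  ring

theorem summable_fourierCoeff_brCircle : Summable (fourierCoeff brCircle) := by
  obtain ⟨C, hC, h⟩ := exists_norm_deltaCoeff_le
  refine Summable.of_norm_bounded_eventually
    ((summable_abs_one_div_int_pow (p := 3) (by norm_num)).mul_left C) ?_
  filter_upwards [(finite_singleton (0 : ℤ)).compl_mem_cofinite] with k hk
  rw [fourierCoeff_brCircle_of_ne hk]
  exact h k hk

theorem delta_eq (x : ℝ) : delta x = (brPer x : ℂ) - brMean := by
  have h := has_pointwise_sum_fourier_series_of_summable summable_fourierCoeff_brCircle
    (x : UnitAddCircle)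
  rw [brCircle_coe] at h
  have h2 := h.summable.tsum_eq_add_tsum_ite 0
  rw [h.tsum_eq, fourierCoeff_brCircle_zero, fourier_zero, smul_eq_mul, mul_one] at h2
  rw [h2, add_sub_cancel_left, delta]
  have := tsum_subtype {k : ℤ | k ≠ 0} fun k : ℤ => deltaCoeff k *
    Complex.exp (2 * Real.pi * Complex.I * k * x)
  refine this.trans (tsum_congr fun k => ?_)
  by_cases hk : k = 0
  · simp [hk]
  · rw [if_neg hk, indicator_of_mem (by exact hk), fourierCoeff_brCircle_of_ne hk,
      fourier_coe_apply, smul_eq_mul, Complex.ofReal_one, div_one]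

theorem continuous_delta : Continuous delta := by
  have : delta = fun x => (brPer x : ℂ) - brMean := funext delta_eq
  rw [this]
  exact (Complex.continuous_ofReal.comp continuous_brPer).sub continuous_const

theorem periodic_delta : Function.Periodic delta 1 := by
  intro x
  rw [delta_eq, delta_eq, periodic_brPer]

/-- Shows that the constant with `ζ'(-1)` is real, which gives the reality of `delta`, and that it
is the mean, which gives mean zero. -/
theorem brMean_eq_integral : brMean = ((∫ x in (0 : ℝ)..1, brPer x : ℝ) : ℂ) := by
  rw [← fourierCoeff_brCircle_zero, fourierCoeff_eq_intervalIntegral _ _ 0, zero_add,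
    ← intervalIntegral.integral_ofReal]
  simp [brCircle_coe]

theorem delta_im (x : ℝ) : (delta x).im = 0 := by
  rw [delta_eq, brMean_eq_integral, ← Complex.ofReal_sub, Complex.ofReal_im]

theorem integral_delta : ∫ x in (0 : ℝ)..1, delta x = 0 := by
  simp_rw [delta_eq]
  rw [intervalIntegral.integral_sub (f := fun x => (brPer x : ℂ))
    ((Complex.continuous_ofReal.comp continuous_brPer).intervalIntegrable _ _)
    intervalIntegrable_const, intervalIntegral.integral_const, brMean_eq_integral,
    intervalIntegral.integral_ofReal]
  simp

theorem exists_norm_delta_sub_le : ∃ K : ℝ, 0 ≤ K ∧ ∀ x y : ℝ,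
    ‖delta x - delta y‖ ≤ K * |x - y| := by
  obtain ⟨C, hC, h⟩ := exists_norm_deltaCoeff_le
  have hs : Summable fun k : {k : ℤ // k ≠ 0} =>
      C * (2 * Real.pi) * |1 / ((k : ℤ) : ℝ) ^ 2| :=
    ((summable_abs_one_div_int_pow (by norm_num)).mul_left _).subtype _
  have hsum : ∀ x : ℝ, Summable fun k : {k : ℤ // k ≠ 0} => deltaCoeff k *
      Complex.exp (2 * Real.pi * Complex.I * (k : ℤ) * x) := by
    intro x
    refine Summable.of_norm_bounded summable_norm_deltaCoeff fun k => le_of_eq ?_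
    rw [norm_mul, show (2 * Real.pi * Complex.I * (k : ℤ) * x : ℂ) =
      ((2 * Real.pi * (k : ℤ) * x : ℝ) : ℂ) * Complex.I by push_cast; ring,
      Complex.norm_exp_ofReal_mul_I, mul_one]
  refine ⟨∑' k : {k : ℤ // k ≠ 0}, C * (2 * Real.pi) * |1 / ((k : ℤ) : ℝ) ^ 2|,
    tsum_nonneg fun k => by positivity, fun x y => ?_⟩
  rw [delta, delta, ← (hsum x).tsum_sub (hsum y), ← tsum_mul_right]
  refine tsum_of_norm_bounded (hs.mul_right _).hasSum fun k => ?_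
  rw [← mul_sub, norm_mul]
  have hk0 : ((k : ℤ) : ℝ) ≠ 0 := by exact_mod_cast k.2
  have he : ‖Complex.exp (2 * Real.pi * Complex.I * (k : ℤ) * x) -
      Complex.exp (2 * Real.pi * Complex.I * (k : ℤ) * y)‖ ≤ 2 * Real.pi * |((k : ℤ) : ℝ)| *
        |x - y| := by
    have e1 : Complex.exp (2 * Real.pi * Complex.I * (k : ℤ) * x) =
        Complex.exp (((2 * Real.pi * (k : ℤ) * y : ℝ) : ℂ) * Complex.I) *
          Complex.exp (Complex.I * ((2 * Real.pi * (k : ℤ) * (x - y) : ℝ) : ℂ)) := by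
      rw [← Complex.exp_add]; congr 1; push_cast; ring
    have e2 : Complex.exp (2 * Real.pi * Complex.I * (k : ℤ) * y) =
        Complex.exp (((2 * Real.pi * (k : ℤ) * y : ℝ) : ℂ) * Complex.I) := by
      congr 1; push_cast; ring
    rw [e1, e2, ← mul_sub_one, norm_mul, Complex.norm_exp_ofReal_mul_I, one_mul]
    refine (Real.norm_exp_I_mul_ofReal_sub_one_le).trans (le_of_eq ?_)
    rw [Real.norm_eq_abs, abs_mul, abs_mul, abs_of_pos (by positivity : 0 < 2 * Real.pi)]
  calc _ ≤ C * |1 / ((k : ℤ) : ℝ) ^ 3| * (2 * Real.pi * |((k : ℤ) : ℝ)| * |x - y|) := by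
        gcongr
        exact h k k.2
    _ = _ := by
        rw [abs_div, abs_div, abs_one, abs_pow, abs_pow]
        have : |((k : ℤ) : ℝ)| ≠ 0 := abs_ne_zero.2 hk0
        field_simp

end TreeBranches

namespace TreeBranches

open MeasureTheory Set Filter Topology

/-! ### Asymptotics of the expected number of branches -/

/-- The correction `∑_{k ≥ 1} k (2 v + v² / 3 - 2 v³ / 3) e^{-v}`, where `v = k² t`. -/
noncomputable def corrSum (t : ℝ) : ℝ :=
  2 * expSum 1 t + 1 / 3 * expSum 2 t - 2 / 3 * expSum 3 t

theorem exists_abs_corrSum_le : ∃ C : ℝ, 0 ≤ C ∧ ∀ t : ℝ, 0 < t → |corrSum t| ≤ C / t ^ 2 := by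
  obtain ⟨C₁, h₁, h₁'⟩ := exists_expSum_le_div_sq 1
  obtain ⟨C₂, h₂, h₂'⟩ := exists_expSum_le_div_sq 2
  obtain ⟨C₃, h₃, h₃'⟩ := exists_expSum_le_div_sq 3
  refine ⟨2 * C₁ + 1 / 3 * C₂ + 2 / 3 * C₃, by positivity, fun t ht => ?_⟩
  have := h₁' t ht
  have := h₂' t ht
  have := h₃' t ht
  have := expSum_nonneg 1 ht
  have := expSum_nonneg 2 ht
  have := expSum_nonneg 3 ht
  rw [corrSum, abs_le, add_div, add_div, mul_div_assoc, mul_div_assoc, mul_div_assoc]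
  constructor <;> linarith

/-- The coefficient is `2 · 1!/2 + (1/3) · 2!/2 - (2/3) · 3!/2 = -2/3`. Having both bounds makes the
sum over `t = 4^r / M` bounded uniformly in `M`. -/
theorem exists_abs_corrSum_add_le : ∃ C : ℝ, 0 ≤ C ∧ ∀ t : ℝ, 0 < t →
    |corrSum t + 2 / 3 / t| ≤ C * t ∧ |corrSum t + 2 / 3 / t| ≤ C / t := by
  obtain ⟨C₁, h₁, h₁'⟩ := exists_abs_expSum_sub_le 1
  obtain ⟨C₂, h₂, h₂'⟩ := exists_abs_expSum_sub_le 2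
  obtain ⟨C₃, h₃, h₃'⟩ := exists_abs_expSum_sub_le 3
  obtain ⟨D₁, i₁, i₁'⟩ := exists_expSum_le_div 1
  obtain ⟨D₂, i₂, i₂'⟩ := exists_expSum_le_div 2
  obtain ⟨D₃, i₃, i₃'⟩ := exists_expSum_le_div 3
  refine ⟨2 * C₁ + 1 / 3 * C₂ + 2 / 3 * C₃ + (2 * D₁ + 1 / 3 * D₂ + 2 / 3 * D₃ + 2 / 3),
    by positivity, fun t ht => ⟨?_, ?_⟩⟩
  · have a := h₁' t ht
    have b := h₂' t ht
    have c := h₃' t ht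
    norm_num [Nat.factorial] at a b c
    have e : corrSum t + 2 / 3 / t = 2 * (expSum 1 t - 1 / 2 / t) + 1 / 3 * (expSum 2 t - 1 / t) -
        2 / 3 * (expSum 3 t - 3 / t) := by rw [corrSum]; ring
    rw [e, abs_le]
    rw [abs_le] at a b c
    have : 0 ≤ (2 * D₁ + 1 / 3 * D₂ + 2 / 3 * D₃ + 2 / 3) * t := by positivity
    norm_num at a b c ⊢
    constructor <;> linarith
  · have := i₁' t ht
    have := i₂' t ht
    have := i₃' t ht
    have := expSum_nonneg 1 ht
    have := expSum_nonneg 2 ht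
    have := expSum_nonneg 3 ht
    have : 0 ≤ (2 * C₁ + 1 / 3 * C₂ + 2 / 3 * C₃) / t := by positivity
    have h : 0 ≤ 2 / 3 / t := by positivity
    have e : (2 * C₁ + 1 / 3 * C₂ + 2 / 3 * C₃ + (2 * D₁ + 1 / 3 * D₂ + 2 / 3 * D₃ + 2 / 3)) / t =
        (2 * C₁ + 1 / 3 * C₂ + 2 / 3 * C₃) / t +
          (2 * (D₁ / t) + 1 / 3 * (D₂ / t) + 2 / 3 * (D₃ / t) + 2 / 3 / t) := by ring
    rw [corrSum, abs_le, e]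
    constructor <;> linarith

theorem hasSum_geometric_quarter (c : ℝ) :
    HasSum (fun r : ℕ => c / (4 : ℝ) ^ r) (c * (4 / 3)) := by
  have h := (hasSum_geometric_of_lt_one (r := (1 / 4 : ℝ)) (by norm_num) (by norm_num)).mul_left c
  have e : (fun r : ℕ => c / (4 : ℝ) ^ r) = fun r => c * (1 / 4) ^ r := by
    funext r; rw [div_pow, one_pow, mul_one_div]
  rw [e, show c * (4 / 3) = c * (1 - 1 / 4)⁻¹ by norm_num]
  exact h

theorem summable_of_abs_le_div_sq {f : ℝ → ℝ} {C : ℝ}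
    (h : ∀ t : ℝ, 0 < t → |f t| ≤ C / t ^ 2) {M : ℝ} (hM : 0 < M) :
    Summable fun r : ℕ => f ((4 : ℝ) ^ r / M) := by
  refine Summable.of_norm_bounded (hasSum_geometric_quarter (C * M ^ 2)).summable fun r => ?_
  have hC : 0 ≤ C := by have := (abs_nonneg _).trans (h 1 one_pos); simpa using this
  refine (h _ (by positivity)).trans ?_
  rw [div_pow, div_div_eq_mul_div]
  gcongr
  exact le_self_pow₀ (one_le_pow₀ (by norm_num)) two_ne_zero

/-- The pointwise error `O(M⁻²)` sums over `k` to `O(M⁻² / t)` with `t = 4^r / M`, that is `O(4^(-r)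
/ M)`, which is summable over `r`. -/
theorem exists_abs_expectedBranches_sub_le : ∃ C : ℝ, 0 ≤ C ∧ ∀ (n : ℕ) (M : ℝ),
    M = (n + 1 : ℕ) + 1 / 2 →
    |expectedBranches n - ∑' r : ℕ, (brSum ((4 : ℝ) ^ r / M) + corrSum ((4 : ℝ) ^ r / M) / M)| ≤
      C / M := by
  obtain ⟨C, hC, h⟩ := exists_abs_branchWeight_sub_le
  obtain ⟨D₀, hD₀, h₀⟩ := exists_expSum_le_div 0
  obtain ⟨D₅, hD₅, h₅⟩ := exists_expSum_le_div 5
  obtain ⟨A, hA, hA'⟩ := exists_abs_brSum_le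
  obtain ⟨B, hB, hB'⟩ := exists_abs_corrSum_le
  refine ⟨C * (D₀ + D₅) * (4 / 3), by positivity, fun n M hM => ?_⟩
  have hM0 : 0 < M := by rw [hM]; positivity
  have key : ∀ r : ℕ, ‖∑' k : ℕ, ((k : ℝ) + 1) * branchWeight (n + 1) ((k + 1) * 2 ^ r) -
      (brSum ((4 : ℝ) ^ r / M) + corrSum ((4 : ℝ) ^ r / M) / M)‖ ≤
        C * (D₀ + D₅) / M / (4 : ℝ) ^ r := by
    intro r
    set t := (4 : ℝ) ^ r / M with ht
    have ht0 : 0 < t := by positivity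
    have s0 := summable_expSum 0 ht0
    have s1 := summable_expSum 1 ht0
    have s2 := summable_expSum 2 ht0
    have s3 := summable_expSum 3 ht0
    have s5 := summable_expSum 5 ht0
    have hg := (((s1.hasSum.mul_left 4).sub (s0.hasSum.mul_left 2)).add
      ((((s1.hasSum.mul_left 2).add (s2.hasSum.mul_left (1 / 3))).sub
        (s3.hasSum.mul_left (2 / 3))).div_const M))
    have he := (s0.hasSum.add s5.hasSum).mul_left (C / M ^ 2)
    change HasSum _ (brSum t + corrSum t / M) at hg
    change HasSum _ (C / M ^ 2 * (expSum 0 t + expSum 5 t)) at he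
    have hfg : ∀ k : ℕ, ‖((k : ℝ) + 1) * branchWeight (n + 1) ((k + 1) * 2 ^ r) -
        (4 * (((k : ℝ) + 1) * ((((k : ℝ) + 1) ^ 2 * t) ^ 1 * Real.exp (-(((k : ℝ) + 1) ^ 2 * t)))) -
          2 * (((k : ℝ) + 1) * ((((k : ℝ) + 1) ^ 2 * t) ^ 0 * Real.exp (-(((k : ℝ) + 1) ^ 2 * t))))
        + (2 * (((k : ℝ) + 1) * ((((k : ℝ) + 1) ^ 2 * t) ^ 1 *
            Real.exp (-(((k : ℝ) + 1) ^ 2 * t)))) +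
          1 / 3 * (((k : ℝ) + 1) * ((((k : ℝ) + 1) ^ 2 * t) ^ 2 *
            Real.exp (-(((k : ℝ) + 1) ^ 2 * t)))) -
          2 / 3 * (((k : ℝ) + 1) * ((((k : ℝ) + 1) ^ 2 * t) ^ 3 *
            Real.exp (-(((k : ℝ) + 1) ^ 2 * t))))) / M)‖ ≤
        C / M ^ 2 * (((k : ℝ) + 1) * ((((k : ℝ) + 1) ^ 2 * t) ^ 0 *
            Real.exp (-(((k : ℝ) + 1) ^ 2 * t))) +
          ((k : ℝ) + 1) * ((((k : ℝ) + 1) ^ 2 * t) ^ 5 *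
            Real.exp (-(((k : ℝ) + 1) ^ 2 * t)))) := by
      intro k
      have hv : ((k : ℝ) + 1) ^ 2 * t = (((k + 1) * 2 ^ r : ℕ) : ℝ) ^ 2 / M := by
        rw [ht]
        push_cast
        rw [mul_pow, ← pow_mul, mul_comm r 2, pow_mul]
        norm_num
        ring
      have h1 := h (n + 1) ((k + 1) * 2 ^ r) (Nat.succ_pos n) M _ hM hv
      have hk : (0 : ℝ) ≤ (k : ℝ) + 1 := by positivity
      have h2 := mul_le_mul_of_nonneg_left h1 hk
      rw [← abs_of_nonneg hk, ← abs_mul, abs_of_nonneg hk] at h2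
      rw [Real.norm_eq_abs]
      refine le_trans (le_of_eq ?_) (h2.trans (le_of_eq ?_))
      · congr 1; ring
      · ring
    have hd := tsum_of_norm_bounded he hfg
    have hsum := (Summable.of_norm_bounded he.summable hfg).add hg.summable
    simp only [sub_add_cancel] at hsum
    rw [hsum.tsum_sub hg.summable, hg.tsum_eq] at hd
    refine hd.trans ?_
    calc C / M ^ 2 * (expSum 0 t + expSum 5 t) ≤ C / M ^ 2 * (D₀ / t + D₅ / t) := by
          gcongr
          · exact h₀ t ht0
          · exact h₅ t ht0
      _ = _ := by rw [ht]; field_simp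
  have hgs : Summable fun r : ℕ =>
      (brSum ((4 : ℝ) ^ r / M) + corrSum ((4 : ℝ) ^ r / M) / M) :=
    (summable_of_abs_le_div_sq hA' hM0).add ((summable_of_abs_le_div_sq hB' hM0).div_const M)
  have hes := hasSum_geometric_quarter (C * (D₀ + D₅) / M)
  have hd := tsum_of_norm_bounded hes key
  have hsum := (Summable.of_norm_bounded hes.summable key).add hgs
  simp only [sub_add_cancel] at hsum
  rw [hsum.tsum_sub hgs, ← expectedBranches_eq_tsum, Real.norm_eq_abs] at hd
  refine hd.trans (le_of_eq ?_)
  ring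

theorem four_rpow_sub_logb {M : ℝ} (hM : 0 < M) (r : ℝ) :
    (4 : ℝ) ^ (r - Real.logb 4 M) = (4 : ℝ) ^ r / M := by
  rw [Real.rpow_sub (by norm_num), Real.rpow_logb (by norm_num) (by norm_num) hM]

/-- Compare with the two-sided sum at `x = log_4 M`. The indices `r < 0` contribute `O(1/M)`, and
the cutoff at `r = 0` removes `M + 1/6`, so the linear term is `M + M/3`. -/
theorem exists_abs_tsum_brSum_sub_le : ∃ C : ℝ, 0 ≤ C ∧ ∀ M : ℝ, 0 < M →
    |∑' r : ℕ, brSum ((4 : ℝ) ^ r / M) - (4 / 3 * M + Real.logb 4 M / 6 +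
      brPer (Real.logb 4 M) + 1 / 6)| ≤ C / M := by
  obtain ⟨C, hC, h⟩ := exists_abs_brSum_sub_le
  obtain ⟨A, hA, hA'⟩ := exists_abs_brSum_le
  refine ⟨C * (4 / 3), by positivity, fun M hM => ?_⟩
  set x := Real.logb 4 M with hx
  have hxM : (4 : ℝ) ^ x = M := Real.rpow_logb (by norm_num) (by norm_num) hM
  have hs := summable_of_abs_le_div_sq hA' hM
  have hpos : ∀ r : ℕ, brTerm r x = brSum ((4 : ℝ) ^ r / M) -
      if r = 0 then M + 1 / 6 else 0 := by
    intro r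
    rw [brTerm, Int.cast_natCast, four_rpow_sub_logb hM, Real.rpow_natCast]
    congr 1
    rcases Nat.eq_zero_or_pos r with hr | hr
    · subst hr; simp [hxM]
    · rw [if_neg (by omega), if_neg (by omega)]
  have hneg : ∀ r : ℕ, ‖brTerm (-((r : ℤ) + 1)) x‖ ≤ C / M / (4 : ℝ) ^ r := by
    intro r
    have e1 : (4 : ℝ) ^ (((-((r : ℤ) + 1) : ℤ) : ℝ) - x) = 1 / ((4 : ℝ) ^ (r + 1) * M) := by
      rw [four_rpow_sub_logb hM]
      push_cast
      rw [Real.rpow_neg (by norm_num), ← Nat.cast_succ, Real.rpow_natCast]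
      field_simp
    have e2 : (4 : ℝ) ^ (x - ((-((r : ℤ) + 1) : ℤ) : ℝ)) = 1 / (1 / ((4 : ℝ) ^ (r + 1) * M)) := by
      rw [← e1, one_div, ← Real.rpow_neg (by norm_num), neg_sub]
    rw [brTerm, if_pos (by omega), e1, e2, ← sub_sub, Real.norm_eq_abs]
    refine (h _ (by positivity)).trans ?_
    rw [mul_one_div, div_div, mul_comm M]
    gcongr
    · norm_num
    · omega
  have s1 : Summable fun r : ℕ => brTerm r x := (summable_brTerm x).comp_injective
    Nat.cast_injective
  have s2 : Summable fun r : ℕ => brTerm (-((r : ℤ) + 1)) x :=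
    Summable.of_norm_bounded (hasSum_geometric_quarter (C / M)).summable hneg
  have ht : brTotal x = ∑' r : ℕ, brTerm r x + ∑' r : ℕ, brTerm (-((r : ℤ) + 1)) x :=
    tsum_of_nat_of_neg_add_one s1 s2
  have h1 : ∑' r : ℕ, brTerm r x = ∑' r : ℕ, brSum ((4 : ℝ) ^ r / M) - (M + 1 / 6) := by
    simp_rw [hpos]
    rw [hs.tsum_sub (summable_of_ne_finset_zero (s := {0}) fun b hb =>
      if_neg (by simpa using hb)), tsum_ite_eq]
  have h2 := tsum_of_norm_bounded (hasSum_geometric_quarter (C / M)) hneg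
  rw [Real.norm_eq_abs] at h2
  have e : ∑' r : ℕ, brSum ((4 : ℝ) ^ r / M) - (4 / 3 * M + x / 6 + brPer x + 1 / 6) =
      -∑' r : ℕ, brTerm (-((r : ℤ) + 1)) x := by
    rw [brPer, ht, h1, hxM]
    ring
  rw [e, abs_neg]
  refine h2.trans (le_of_eq ?_)
  ring

theorem exists_abs_tsum_corrSum_add_le : ∃ C : ℝ, 0 ≤ C ∧ ∀ M : ℝ, 0 < M →
    |∑' r : ℕ, corrSum ((4 : ℝ) ^ r / M) / M + 8 / 9| ≤ C / M := by
  obtain ⟨C, hC, h⟩ := exists_abs_corrSum_add_le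
  obtain ⟨B, hB, hB'⟩ := exists_abs_corrSum_le
  refine ⟨4 * C * ∑' r : ℤ, (1 / 4 : ℝ) ^ r.natAbs,
    mul_nonneg (by positivity) (tsum_nonneg fun r => by positivity), fun M hM => ?_⟩
  set x := Real.logb 4 M with hx
  -- The error peaks where `4^r` is about `M` and decays geometrically on both sides. The factor `4`
  -- pays for replacing `x` by its floor.
  have hb : ∀ r : ℕ, ‖corrSum ((4 : ℝ) ^ r / M) + 2 / 3 / ((4 : ℝ) ^ r / M)‖ ≤
      4 * C * (1 / 4 : ℝ) ^ ((r : ℤ) - ⌊x⌋).natAbs := by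
    intro r
    have ht : (4 : ℝ) ^ r / M = (4 : ℝ) ^ ((r : ℝ) - x) := by
      rw [four_rpow_sub_logb hM, Real.rpow_natCast]
    have habs : 4 * C * (1 / 4 : ℝ) ^ ((r : ℤ) - ⌊x⌋).natAbs =
        C * (4 : ℝ) ^ (1 - |(r : ℝ) - ⌊x⌋|) := by
      rw [Real.rpow_sub (by norm_num), Real.rpow_one]
      have e : |(r : ℝ) - ⌊x⌋| = ((((r : ℤ) - ⌊x⌋).natAbs : ℕ) : ℝ) := by
        rw [Nat.cast_natAbs]; push_cast; rfl
      rw [e, Real.rpow_natCast, one_div, inv_pow]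
      ring
    have h0 := Int.floor_le x
    have h1 := Int.lt_floor_add_one x
    rw [habs, ht, Real.norm_eq_abs]
    obtain ⟨ha, hb⟩ := h ((4 : ℝ) ^ ((r : ℝ) - x)) (by positivity)
    rcases le_or_gt (r : ℤ) ⌊x⌋ with hr | hr
    · have hr' : (r : ℝ) ≤ ⌊x⌋ := by exact_mod_cast hr
      refine ha.trans (mul_le_mul_of_nonneg_left
        (Real.rpow_le_rpow_of_exponent_le (by norm_num) ?_) hC)
      rw [abs_of_nonpos (by linarith)]
      linarith
    · have hr' : (⌊x⌋ : ℝ) + 1 ≤ r := by exact_mod_cast hr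
      refine hb.trans ?_
      rw [div_eq_mul_inv, ← Real.rpow_neg (by norm_num)]
      refine mul_le_mul_of_nonneg_left (Real.rpow_le_rpow_of_exponent_le (by norm_num) ?_) hC
      rw [abs_of_nonneg (by linarith)]
      linarith
  have hsZ : Summable fun r : ℤ => 4 * C * (1 / 4 : ℝ) ^ (r - ⌊x⌋).natAbs :=
    ((Equiv.subRight ⌊x⌋).summable_iff.2 summable_quarter_pow_natAbs).mul_left _
  have hsN : Summable fun r : ℕ => 4 * C * (1 / 4 : ℝ) ^ ((r : ℤ) - ⌊x⌋).natAbs :=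
    hsZ.comp_injective Nat.cast_injective
  have h1 := tsum_of_norm_bounded hsN.hasSum hb
  have h2 : ∑' r : ℕ, 4 * C * (1 / 4 : ℝ) ^ ((r : ℤ) - ⌊x⌋).natAbs ≤
      4 * C * ∑' r : ℤ, (1 / 4 : ℝ) ^ r.natAbs := by
    have hinj : Function.Injective fun r : ℕ => (r : ℤ) := Nat.cast_injective
    refine (Summable.tsum_le_tsum_of_inj (f := fun r : ℕ =>
      4 * C * (1 / 4 : ℝ) ^ ((r : ℤ) - ⌊x⌋).natAbs)
      (g := fun r : ℤ => 4 * C * (1 / 4 : ℝ) ^ (r - ⌊x⌋).natAbs) (fun r : ℕ => (r : ℤ)) hinj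
      (fun _ _ => by positivity) (fun _ => le_rfl) hsN hsZ).trans (le_of_eq ?_)
    rw [tsum_mul_left]
    congr 1
    exact (Equiv.subRight ⌊x⌋).tsum_eq fun r : ℤ => (1 / 4 : ℝ) ^ r.natAbs
  have hs := summable_of_abs_le_div_sq hB' hM
  have hg : HasSum (fun r : ℕ => 2 / 3 / ((4 : ℝ) ^ r / M)) (8 / 9 * M) := by
    convert hasSum_geometric_quarter (2 / 3 * M) using 1
    · funext r; field_simp
    · ring
  rw [hs.tsum_add hg.summable, hg.tsum_eq, Real.norm_eq_abs] at h1
  rw [tsum_div_const, show (∑' r : ℕ, corrSum ((4 : ℝ) ^ r / M)) / M + 8 / 9 =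
    (∑' r : ℕ, corrSum ((4 : ℝ) ^ r / M) + 8 / 9 * M) / M by field_simp, abs_div, abs_of_pos hM]
  gcongr
  exact h1.trans h2

/-! ### Assembly of the expansion, in terms of `M` and then of `n`. -/

theorem exists_abs_expectedBranches_sub_brPer_le : ∃ C : ℝ, 0 ≤ C ∧ ∀ (n : ℕ) (M : ℝ),
    M = (n + 1 : ℕ) + 1 / 2 → |expectedBranches n - (4 / 3 * M + Real.logb 4 M / 6 +
      brPer (Real.logb 4 M) + 1 / 6 - 8 / 9)| ≤ C / M := by
  obtain ⟨C₁, h₁, h₁'⟩ := exists_abs_expectedBranches_sub_le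
  obtain ⟨C₂, h₂, h₂'⟩ := exists_abs_tsum_brSum_sub_le
  obtain ⟨C₃, h₃, h₃'⟩ := exists_abs_tsum_corrSum_add_le
  obtain ⟨A, hA, hA'⟩ := exists_abs_brSum_le
  obtain ⟨B, hB, hB'⟩ := exists_abs_corrSum_le
  refine ⟨C₁ + C₂ + C₃, by positivity, fun n M hM => ?_⟩
  have hM0 : 0 < M := by rw [hM]; positivity
  have a := h₁' n M hM
  have b := h₂' M hM0
  have c := h₃' M hM0
  rw [(summable_of_abs_le_div_sq hA' hM0).tsum_add
    ((summable_of_abs_le_div_sq hB' hM0).div_const M)] at a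
  rw [abs_le] at a b c ⊢
  rw [add_div, add_div]
  constructor <;> linarith

theorem logb_add_sub_logb_le {n : ℕ} (hn : 0 < n) :
    |Real.logb 4 ((n + 1 : ℕ) + 1 / 2) - Real.logb 4 n| ≤ 3 / 2 / n := by
  have hn' : (0 : ℝ) < n := by exact_mod_cast hn
  have hL : 1 ≤ Real.log 4 := by
    rw [log_four]; linarith [Real.log_two_gt_d9]
  have e : Real.logb 4 ((n + 1 : ℕ) + 1 / 2) - Real.logb 4 n =
      Real.log (1 + 3 / 2 / n) / Real.log 4 := by
    rw [Real.logb, Real.logb, ← sub_div, ← Real.log_div (by positivity) hn'.ne']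
    congr 2
    push_cast
    field_simp
    ring
  have h0 : 0 ≤ 3 / 2 / (n : ℝ) := by positivity
  have h1 : 0 ≤ Real.log (1 + 3 / 2 / n) := Real.log_nonneg (by linarith)
  have h2 : Real.log (1 + 3 / 2 / n) ≤ 3 / 2 / n := by
    have := Real.log_le_sub_one_of_pos (show 0 < 1 + 3 / 2 / (n : ℝ) by positivity)
    linarith
  rw [e, abs_of_nonneg (by positivity), div_le_iff₀ (by linarith)]
  nlinarith

theorem isBigO_expectedBranches :
    (fun n : ℕ => (expectedBranches n : ℂ) -
        (4 * (n : ℂ) / 3 + 1 / 6 * (Real.logb 4 n : ℂ)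
          - 2 * deriv riemannZeta (-1) / (Real.log 2 : ℂ)
          - (Real.eulerMascheroniConstant : ℂ) / (12 * (Real.log 2 : ℂ))
          - 1 / (6 * (Real.log 2 : ℂ)) + 43 / 36
          + delta (Real.logb 4 n)))
      =O[Filter.atTop] (fun n : ℕ => Real.log n / n) := by
  obtain ⟨C, hC, h⟩ := exists_abs_expectedBranches_sub_brPer_le
  obtain ⟨K, hK, hd⟩ := exists_norm_delta_sub_le
  have hl2 : (Real.log 2 : ℂ) ≠ 0 := Complex.ofReal_ne_zero.2 (Real.log_pos (by norm_num)).ne'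
  refine Asymptotics.IsBigO.of_bound (C + 3 / 2 + K * (3 / 2)) ?_
  filter_upwards [eventually_ge_atTop 3] with n hn
  have hn' : (3 : ℝ) ≤ n := by exact_mod_cast hn
  have hn0 : (0 : ℝ) < n := by linarith
  set M : ℝ := (n + 1 : ℕ) + 1 / 2 with hM
  have hnM : (n : ℝ) ≤ M := by rw [hM]; push_cast; linarith
  -- The error obtained is `O(1/n)`; it is weakened to `O(log n / n)` only through this inequality.
  have hlog : 1 ≤ Real.log n := by
    rw [Real.le_log_iff_exp_le hn0]
    linarith [Real.exp_one_lt_d9]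
  have h1 := h n M hM
  have h2 := logb_add_sub_logb_le (n := n) (by omega)
  rw [← hM] at h2
  have h3 := hd (Real.logb 4 M) (Real.logb 4 n)
  -- Since `M = n + 3/2`, the linear term contributes `2`, and `2 + 1/6 - 8/9 - 1/12 = 43/36`, where
  -- `-1/12` comes from `brMean`.
  have e : (expectedBranches n : ℂ) -
        (4 * (n : ℂ) / 3 + 1 / 6 * (Real.logb 4 n : ℂ)
          - 2 * deriv riemannZeta (-1) / (Real.log 2 : ℂ)
          - (Real.eulerMascheroniConstant : ℂ) / (12 * (Real.log 2 : ℂ))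
          - 1 / (6 * (Real.log 2 : ℂ)) + 43 / 36
          + delta (Real.logb 4 n)) =
      ((expectedBranches n - (4 / 3 * M + Real.logb 4 M / 6 +
        brPer (Real.logb 4 M) + 1 / 6 - 8 / 9) : ℝ) : ℂ) +
      ((1 / 6 * (Real.logb 4 M - Real.logb 4 n) : ℝ) : ℂ) +
      (delta (Real.logb 4 M) - delta (Real.logb 4 n)) := by
    rw [delta_eq (Real.logb 4 M), brMean, log_four, hM]
    push_cast
    field_simp
    ring
  have h4 : C / M ≤ C / n := by gcongr
  rw [e]
  refine (norm_add₃_le).trans ?_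
  rw [Complex.norm_real, Complex.norm_real, Real.norm_eq_abs, Real.norm_eq_abs, Real.norm_eq_abs,
    abs_mul, abs_of_nonneg (show (0 : ℝ) ≤ Real.log n / n by positivity)]
  have h5 : K * |Real.logb 4 M - Real.logb 4 n| ≤ K * (3 / 2 / n) := by gcongr
  have h6 : |(1 / 6 : ℝ)| * |Real.logb 4 M - Real.logb 4 n| ≤ 1 * (3 / 2 / n) := by
    gcongr
    rw [abs_of_pos] <;> norm_num
  calc _ ≤ C / n + 1 * (3 / 2 / n) + K * (3 / 2 / n) := by
        gcongr
        · exact h1.trans h4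
        · exact h3.trans h5
    _ = (C + 3 / 2 + K * (3 / 2)) * (1 / n) := by ring
    _ ≤ _ := by gcongr

end TreeBranches

theorem mainTheorem1 :
    Summable (fun k : {k : ℤ // k ≠ 0} => ‖TreeBranches.deltaCoeff k‖) ∧
    Continuous TreeBranches.delta ∧
    (∀ x : ℝ, (TreeBranches.delta x).im = 0) ∧
    Function.Periodic TreeBranches.delta 1 ∧
    (∫ x in (0 : ℝ)..1, TreeBranches.delta x) = 0 ∧
    (fun n : ℕ => (TreeBranches.expectedBranches n : ℂ) -
        (4 * (n : ℂ) / 3 + 1 / 6 * (Real.logb 4 n : ℂ)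
          - 2 * deriv riemannZeta (-1) / (Real.log 2 : ℂ)
          - (Real.eulerMascheroniConstant : ℂ) / (12 * (Real.log 2 : ℂ))
          - 1 / (6 * (Real.log 2 : ℂ)) + 43 / 36
          + TreeBranches.delta (Real.logb 4 n)))
      =O[Filter.atTop] (fun n : ℕ => Real.log n / n) :=
  ⟨TreeBranches.summable_norm_deltaCoeff, TreeBranches.continuous_delta, TreeBranches.delta_im,
    TreeBranches.periodic_delta, TreeBranches.integral_delta, TreeBranches.isBigO_expectedBranches⟩
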